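/- Let $(X,Q)$ be a random vector with values in $\{0,1,2,\dots\}\times[0,1]$. Let $G(x,p)$ denote the Bernoulli random graph on the vertex set $\{1,\dots,x\}$ (with no vertices if $x=0$), in which every pair of vertices is adjacent independently with probability $p$, and let $G(X,Q)$ be the corresponding mixture: given $(X,Q)=(x,q)$ it is distributed as $G(x,q)$. For $n,m\ge 1$ let the random graph $G_{[n,m]}$ be the superposition of $m$ independent layers on the vertex set $[n]=\{1,\dots,n\}$, defined as follows. Let $(X_1,Q_1),\dots,(X_m,Q_m)$ be independent copies of $(X,Q)$. Given these, independently for $1\le i\le m$, let $\mathcal V_{n,i}$ be a uniformly random subset of $[n]$ of size $\min\{X_i,n\}$ and, given $\mathcal V_{n,i}$, let $G_{n,i}$ be the random graph on $\mathcal V_{n,i}$ in which every pair of vertices is adjacent independently with probability $Q_i$. Then $G_{[n,m]}$ has vertex set $[n]$, and its edge set is the union of the edge sets of $G_{n,1},\dots,G_{n,m}$. Let $F$ be a finite graph with $v_F\ge 3$ vertices and $e_F$ edges that is $2$-connected, that is, $F$ is connected and stays connected when any one of its vertices is removed. A copy of $F$ in a graph $G$ is a (not necessarily induced) subgraph of $G$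 isomorphic to $F$. Let $N_F$ be the number of copies of $F$ in $G(X,Q)$, let $\sigma_F^2=\mathbf{Var}\,N_F\in[0,\infty]$, and let $\mathcal N_F$ be the number of copies of $F$ in $G_{[n,m]}$. **Theorem.** Let $\nu>0$, and let $n,m\to+\infty$ so that $m/n\to\nu$. Assume that $\mathbf E X<\infty$ and $0<\sigma_F^2<\infty$, and that $$\mathbf E\Bigl(X^{1+s\left(1-\frac{1}{2e_F}\right)}Q^{s}\Bigr)<\infty\qquad\text{for each } s=1,2,\dots,v_F-1 .$$ Then $(\mathcal N_F-\mathbf E\,\mathcal N_F)/(\sigma_F\sqrt m)$ converges in distribution to the standard normal distribution. -/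

import Mathlib

open MeasureTheory ProbabilityTheory Filter Topology unitInterval
open scoped ENNReal SimpleGraph

namespace CommunityNetwork

/-- A graph is 2-connected if it is connected and stays connected when any one of its vertices is
removed. -/
def TwoConnected {W : Type*} (F : SimpleGraph W) : Prop :=
  F.Connected ∧ ∀ v : W, (F.induce {v}ᶜ).Connected

instance {V : Type*} [Finite V] : MeasurableSingletonClass (SimpleGraph V) where
  measurableSet_singleton G := by
    have h : ({G} : Set (SimpleGraph V)) = SimpleGraph.edgeSet ⁻¹' {G.edgeSet} := by
      ext H; simp
    rw [h]
    exact SimpleGraph.measurable_edgeSet (measurableSet_singleton _)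

lemma measurable_binomialRandom (V : Type*) [Finite V] :
    Measurable fun p : I ↦ SimpleGraph.binomialRandom V p := by
  refine Measure.measurable_of_measurable_coe _ fun S _ ↦ ?_
  classical
  have := Fintype.ofFinite (SimpleGraph V)
  have h (p : I) : SimpleGraph.binomialRandom V p S
      = ∑ G ∈ S.toFinset, SimpleGraph.binomialRandom V p {G} := by
    rw [sum_measure_singleton, Set.coe_toFinset]
  simp only [h, SimpleGraph.binomialRandom_singleton]
  have h1 : Measurable fun p : I ↦ (toNNReal p : ℝ≥0∞) := by
    have : Continuous fun p : I ↦ toNNReal p := by unfold toNNReal; fun_prop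
    exact this.measurable.coe_nnreal_ennreal
  have h2 : Measurable fun p : I ↦ (toNNReal (σ p) : ℝ≥0∞) :=
    h1.comp unitInterval.continuous_symm.measurable
  exact Finset.measurable_sum _ fun G _ ↦ (h1.pow_const _).mul (h2.pow_const _)

lemma measurable_sigmaMk (x : ℕ) :
    Measurable fun G : SimpleGraph (Fin x) ↦ (⟨x, G⟩ : Σ y : ℕ, SimpleGraph (Fin y)) :=
  fun _ _ ↦ (Set.toFinite _).measurableSet

/-! ### The mixture `G(X, Q)` of Bernoulli random graphs -/

/-- The conditional law of `G(X, Q)` given `(X, Q) = (x, q)`: the Bernoulli random graph on `x`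
vertices, in which each pair of vertices is adjacent independently with probability `q`. -/
noncomputable def bernoulliGraphKernel : Kernel (ℕ × I) (Σ x : ℕ, SimpleGraph (Fin x)) where
  toFun a := (SimpleGraph.binomialRandom (Fin a.1) a.2).map fun G ↦ ⟨a.1, G⟩
  measurable' := measurable_from_prod_countable_right fun x ↦
    (Measure.measurable_map _ (measurable_sigmaMk x)).comp
      (measurable_binomialRandom (Fin x))

/-- The law of the mixed Bernoulli random graph `G(X, Q)`, where `(X, Q)` has law `μ`. -/
noncomputable def mixedGraphLaw (μ : Measure (ℕ × I)) : Measure (Σ x : ℕ, SimpleGraph (Fin x)) :=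
  μ.bind bernoulliGraphKernel

/-- The number `N_F` of copies of `F` (subgraphs isomorphic to `F`, not necessarily induced)
in a realisation of `G(X, Q)`. -/
noncomputable def layerCount {W : Type*} (F : SimpleGraph W)
    (g : Σ x : ℕ, SimpleGraph (Fin x)) : ℝ :=
  (g.2.copyCount F : ℝ)

/-- `σ_F² = Var N_F` as an extended nonnegative number; it is `∞` unless `E N_F² < ∞`. -/
noncomputable def sigmaSq {W : Type*} (F : SimpleGraph W) (μ : Measure (ℕ × I)) : ℝ≥0∞ :=
  evariance (layerCount F) (mixedGraphLaw μ)

/-! ### The superposition `G_{[n,m]}` -/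

/-- The conditional law of the vertex set of a layer given `(X, Q) = (x, q)`: uniform among the
subsets of `[n]` of size `min x n` (so it is all of `[n]` if `x ≥ n`). -/
noncomputable def vertexSetKernel (n : ℕ) : Kernel (ℕ × I) (Finset (Fin n)) where
  toFun a := uniformOn {V : Finset (Fin n) | V.card = min a.1 n}
  measurable' := measurable_from_prod_countable_right fun x ↦
    measurable_const (a := uniformOn {V : Finset (Fin n) | V.card = min x n})

/-- The conditional law of the edges of a layer given `(X, Q) = (x, q)` and given its vertex set
`V`: the Bernoulli random graph on `V` with edge probability `q`, viewed as a graph on `[n]`. -/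
noncomputable def edgeKernel (n : ℕ) :
    Kernel ((ℕ × I) × Finset (Fin n)) (SimpleGraph (Fin n)) where
  toFun a := (SimpleGraph.binomialRandom a.2 a.1.2).map
    (SimpleGraph.map (Subtype.val : a.2 → Fin n))
  measurable' := measurable_from_prod_countable_left fun V ↦
    (Measure.measurable_map (SimpleGraph.map (Subtype.val : V → Fin n))
      fun _ _ ↦ (Set.toFinite _).measurableSet).comp
        ((measurable_binomialRandom V).comp measurable_snd)

/-- A layer: its parameters `(X_i, Q_i)`, its vertex set `V_{n,i}`, and the graph `G_{n,i}`
(viewed as a graph on `[n]`). -/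
abbrev Layer (n : ℕ) : Type := (ℕ × I) × Finset (Fin n) × SimpleGraph (Fin n)

/-- The law of a single layer when `(X, Q)` has law `μ`. -/
noncomputable def layerLaw (μ : Measure (ℕ × I)) (n : ℕ) : Measure (Layer n) :=
  μ ⊗ₘ (vertexSetKernel n ⊗ₖ edgeKernel n)

/-- The joint law of `m` independent layers. -/
noncomputable def networkLaw (μ : Measure (ℕ × I)) (n m : ℕ) : Measure (Fin m → Layer n) :=
  Measure.pi fun _ ↦ layerLaw μ n

/-- The superposition `G_{[n,m]}` of the layers: the graph on `[n]` whose edge set is the union of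
the edge sets of the layers. -/
def superposition {n m : ℕ} (ω : Fin m → Layer n) : SimpleGraph (Fin n) :=
  ⨆ i, (ω i).2.2

/-- The number `𝒩_F` of copies of `F` in `G_{[n,m]}`. -/
noncomputable def networkCount {W : Type*} (F : SimpleGraph W) {n m : ℕ} (ω : Fin m → Layer n) :
    ℝ :=
  ((superposition ω).copyCount F : ℝ)

/-! ### These measures are probability measures -/

instance : IsMarkovKernel bernoulliGraphKernel where
  isProbabilityMeasure a := Measure.isProbabilityMeasure_map (measurable_sigmaMk a.1).aemeasurable

instance (n : ℕ) : IsMarkovKernel (vertexSetKernel n) where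
  isProbabilityMeasure a := by
    refine isProbabilityMeasure_uniformOn
      (s := {V : Finset (Fin n) | V.card = min a.1 n}) (Set.toFinite _) ?_
    obtain ⟨V, _, hV⟩ := Finset.exists_subset_card_eq
      (s := (Finset.univ : Finset (Fin n))) (n := min a.1 n) (by simp)
    exact ⟨V, hV⟩

instance (n : ℕ) : IsMarkovKernel (edgeKernel n) where
  isProbabilityMeasure _ :=
    Measure.isProbabilityMeasure_map
      (Measurable.aemeasurable fun _ _ ↦ (Set.toFinite _).measurableSet)

instance (μ : Measure (ℕ × I)) [IsProbabilityMeasure μ] :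
    IsProbabilityMeasure (mixedGraphLaw μ) := by
  unfold mixedGraphLaw; infer_instance

instance (μ : Measure (ℕ × I)) [IsProbabilityMeasure μ] (n : ℕ) :
    IsProbabilityMeasure (layerLaw μ n) := by
  unfold layerLaw; infer_instance

instance (μ : Measure (ℕ × I)) [IsProbabilityMeasure μ] (n m : ℕ) :
    IsProbabilityMeasure (networkLaw μ n m) := by
  unfold networkLaw; infer_instance

end CommunityNetwork

/-!
A copy of `F` in the union of the layers either lies in a single layer or takes its edges from several
layers. Up to a remainder due to the latter (and to copies that lie in two layers at once), the count
is therefore a sum of `m` independent identically distributed counts, one for each layer, and the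
theorem follows from the classical central limit theorem once the remainder is shown to be `o(√m)`
in mean.

*The remainder.* A copy that uses several layers comes with a placement `φ : W ↪ [n]` and a
nonconstant assignment `f` of layers to the edges of `F` (`abs_copyCount_iSup_sub_sum_le`). The layers
being independent, the probability of such a configuration is a product over the colour classes of
`f`. A layer contains a given graph of rank `s` (vertices minus components) with probability at most
`E[((X ∧ n) / n) ^ (s + 1) Q ^ s]` (`layerLaw_real_setOf_map_le`), which by the moment conditions is
`o(n ^ (-(s + 1) + s / (2 e_F)))` (`tendsto_rpow_mul_integral_containDensity`). There are at most
`n ^ v_F` placements and of order `m ^ r` assignments that use `r` layers, so, as `m` is of order `n`,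
the expected number of configurations is `o(n ^ (v_F - R + R / (2 e_F)))`, where `R` is the sum of the
ranks of the classes. Clearly `R ≤ e_F`. Since `F` is 2-connected its graphic matroid is connected,
which gives `R ≥ v_F` (`card_le_sum_rank_colourClass`); hence the exponent is at most `1 / 2`.

*The main term.* The count in one layer has the law of the number of copies of `F` among the first
`X ∧ n` vertices of `G(X, Q)` (`map_layerLaw_eq_map_mixedGraphLaw`). On that space it is dominated by
`N_F` and equal to it for large `n`, so it converges to `N_F` in mean square. This allows to compare the
normalised sums in mean with sums of independent copies of `N_F`
(`tendsto_charFun_sum_of_tendsto_variance`).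
-/

namespace CommunityNetwork

/-! ### The binomial random graph: containment probabilities and restriction -/

section

lemma binomialRandom_setOf_le {V : Type*} [Finite V] (p : I) (H : SimpleGraph V) :
    SimpleGraph.binomialRandom V p {G | H ≤ G} = (toNNReal p : ℝ≥0∞) ^ H.edgeSet.ncard := by
  classical
  cases nonempty_fintype V
  rw [SimpleGraph.binomialRandom_eq_map, Measure.map_apply SimpleGraph.measurable_fromEdgeSet
    (Set.toFinite _).measurableSet, setBernoulli_apply']
  have h : (fun q : Sym2 V → Prop ↦ {i | q i}) ⁻¹'
      (SimpleGraph.fromEdgeSet ⁻¹' {G : SimpleGraph V | H ≤ G})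
      = Set.pi (H.edgeFinset : Set (Sym2 V)) fun _ ↦ {True} := by
    ext q
    simp only [Set.mem_preimage, Set.mem_ofPred_eq, Set.mem_pi, SimpleGraph.coe_edgeFinset,
      Set.mem_singleton_iff, eq_iff_iff, iff_true]
    constructor
    · intro hq e he
      induction e with
      | _ a b => exact ((SimpleGraph.fromEdgeSet_adj _).1 (hq he)).1
    · intro hq a b hab
      exact (SimpleGraph.fromEdgeSet_adj _).2 ⟨hq s(a, b) hab, hab.ne⟩
  rw [h, Measure.infinitePi_pi _ (fun _ _ ↦ MeasurableSet.of_discrete)]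
  rw [Finset.prod_congr rfl (g := fun _ ↦ (toNNReal p : ℝ≥0∞)), Finset.prod_const,
    ← Set.ncard_coe_finset, SimpleGraph.coe_edgeFinset]
  intro e he
  have he' : ¬ e.IsDiag := H.not_isDiag_of_mem_edgeSet (by simpa using he)
  simp [he']

/-- On a finite vertex set the law of a random graph is determined by the probabilities that it
contains a given graph. -/
lemma measure_ext_of_setOf_le {V : Type*} [Finite V] (P₁ P₂ : Measure (SimpleGraph V))
    [IsProbabilityMeasure P₁] [IsProbabilityMeasure P₂]
    (h : ∀ H : SimpleGraph V, P₁ {G | H ≤ G} = P₂ {G | H ≤ G}) : P₁ = P₂ := by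
  classical
  set C : Set (Set (SimpleGraph V)) := Set.range fun H ↦ {G | H ≤ G}
  have hgen : (inferInstance : MeasurableSpace (SimpleGraph V)) = MeasurableSpace.generateFrom C := by
    refine le_antisymm ?_ ?_
    · have hid : @Measurable _ _ (MeasurableSpace.generateFrom C) inferInstance
          (id : SimpleGraph V → SimpleGraph V) := by
        refine (@SimpleGraph.measurable_iff_adj V _ (MeasurableSpace.generateFrom C) _).2 ?_
        intro u v
        refine (@measurableSet_setOfPred _ (MeasurableSpace.generateFrom C) _).1 ?_
        by_cases huv : u = v
        · subst huv
          simp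
        · refine MeasurableSpace.measurableSet_generateFrom ⟨SimpleGraph.edge u v, ?_⟩
          ext G
          simp only [Set.mem_ofPred_eq, id]
          rw [SimpleGraph.edge_le_iff]
          simp [huv]
      intro s hs
      exact hid hs
    · exact MeasurableSpace.generateFrom_le fun s _ ↦ (Set.toFinite s).measurableSet
  -- The sets `{G | H ≤ G}` form a π-system: intersections correspond to unions of the graphs `H`.
  refine ext_of_generate_finite C hgen ?_ ?_ (by simp)
  · rintro _ ⟨H₁, rfl⟩ _ ⟨H₂, rfl⟩ _
    exact ⟨H₁ ⊔ H₂, by ext G; simp⟩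
  · rintro _ ⟨H, rfl⟩
    exact h H

/-- The restriction of a binomial random graph to a subset of its vertices is a binomial random
graph. -/
lemma map_comap_binomialRandom {U V : Type*} [Finite U] [Finite V] (ι : V ↪ U) (p : I) :
    (SimpleGraph.binomialRandom U p).map (SimpleGraph.comap ι)
      = SimpleGraph.binomialRandom V p := by
  have hm : Measurable (SimpleGraph.comap ι) := fun _ _ ↦ (Set.toFinite _).measurableSet
  have := Measure.isProbabilityMeasure_map (μ := SimpleGraph.binomialRandom U p) hm.aemeasurable
  refine measure_ext_of_setOf_le _ _ fun H ↦ ?_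
  rw [Measure.map_apply hm (Set.toFinite _).measurableSet, binomialRandom_setOf_le]
  have h : SimpleGraph.comap ι ⁻¹' {G | H ≤ G} = {G | H.map ι ≤ G} := by
    ext G
    exact (SimpleGraph.map_le_iff_le_comap ι H G).symm
  rw [h, binomialRandom_setOf_le, SimpleGraph.edgeSet_map,
    Set.ncard_image_of_injective _ ι.sym2Map.injective]

end

/-! ### Counting copies of a graph without isolated vertices -/

section

variable {V W : Type*} {F : SimpleGraph W}

/-- For `F` without isolated vertices a copy of `F` is determined by its edges. -/
lemma copyCount_eq_ncard [Fintype V] (hF : F.support = Set.univ) (G : SimpleGraph V) :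
    G.copyCount F = {H | H ∈ Set.range (fun φ : W ↪ V ↦ F.map φ) ∧ H ≤ G}.ncard := by
  classical
  have hco : ∀ f : F.Copy G, f.toSubgraph.spanningCoe = F.map f.toEmbedding := by
    intro f
    ext a b
    simp [Relation.Map]
    rfl
  have hverts : ∀ f : F.Copy G, f.toSubgraph.verts = f.toSubgraph.spanningCoe.support := by
    intro f
    rw [hco, SimpleGraph.support_map, hF]
    rfl
  have hset : {H | H ∈ Set.range (fun φ : W ↪ V ↦ F.map φ) ∧ H ≤ G}
      = SimpleGraph.Subgraph.spanningCoe '' {G' : G.Subgraph | Nonempty (F ≃g G'.coe)} := by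
    rw [← SimpleGraph.Copy.range_toSubgraph]
    ext H
    constructor
    · rintro ⟨⟨φ, rfl⟩, hφ⟩
      refine ⟨_, ⟨⟨⟨φ, fun {a b} h ↦ hφ ((SimpleGraph.map_adj_apply (f := φ)).2 h)⟩,
        φ.injective⟩, rfl⟩, ?_⟩
      rw [hco]
      rfl
    · rintro ⟨_, ⟨f, rfl⟩, rfl⟩
      exact ⟨⟨f.toEmbedding, (hco f).symm⟩, SimpleGraph.Subgraph.spanningCoe_le _⟩
  rw [hset, Set.InjOn.ncard_image, SimpleGraph.copyCount, ← Set.ncard_coe_finset]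
  · congr
    ext
    simp
  · rw [← SimpleGraph.Copy.range_toSubgraph]
    rintro _ ⟨f, rfl⟩ _ ⟨g, rfl⟩ h
    refine SimpleGraph.Subgraph.ext ?_ ?_
    · rw [hverts, hverts, h]
    · ext a b
      exact (SimpleGraph.ext_iff.1 h ▸ Iff.rfl : f.toSubgraph.spanningCoe.Adj a b ↔ g.toSubgraph.spanningCoe.Adj a b)

lemma copyCount_map [Fintype V] {U : Type*} [Fintype U] (hF : F.support = Set.univ) (ι : V ↪ U)
    (G : SimpleGraph V) : (G.map ι).copyCount F = G.copyCount F := by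
  rw [copyCount_eq_ncard hF, copyCount_eq_ncard hF,
    ← Set.ncard_image_of_injective _ (SimpleGraph.map_injective ι)]
  congr 1
  ext H
  constructor
  · rintro ⟨⟨φ, rfl⟩, hφ⟩
    have hr : ∀ w, ∃ v, ι v = φ w := by
      intro w
      obtain ⟨u, hu⟩ : w ∈ F.support := hF ▸ Set.mem_univ w
      obtain ⟨v, _, _, hv, _⟩ := (SimpleGraph.map_adj ι G _ _).1
        (hφ (SimpleGraph.map_adj_apply.2 hu))
      exact ⟨v, hv⟩
    choose ψ hψ using hr
    have hψi : Function.Injective ψ := fun a b h ↦ φ.injective (by rw [← hψ a, ← hψ b, h])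
    have heq : (F.map (⟨ψ, hψi⟩ : W ↪ V)).map ι = F.map φ := by
      rw [SimpleGraph.map_map]
      congr 1
      ext w
      exact hψ w
    refine ⟨F.map (⟨ψ, hψi⟩ : W ↪ V), ⟨⟨_, rfl⟩, ?_⟩, heq⟩
    have h2 := hφ
    simp only [← heq] at h2
    rw [SimpleGraph.map_le_iff_le_comap, SimpleGraph.comap_map_eq] at h2
    exact h2
  · rintro ⟨_, ⟨⟨φ, rfl⟩, hφ⟩, rfl⟩
    exact ⟨⟨φ.trans ι, (SimpleGraph.map_map F φ ι).symm⟩, SimpleGraph.map_monotone ι hφ⟩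

lemma copyCount_mono [Fintype V] (hF : F.support = Set.univ) {G G' : SimpleGraph V} (h : G ≤ G') :
    G.copyCount F ≤ G'.copyCount F := by
  rw [copyCount_eq_ncard hF, copyCount_eq_ncard hF]
  exact Set.ncard_le_ncard (fun H hH ↦ ⟨hH.1, hH.2.trans h⟩) (Set.toFinite _)

lemma copyCount_comap_le [Fintype V] {U : Type*} [Fintype U] (hF : F.support = Set.univ)
    (ι : V ↪ U) (G : SimpleGraph U) : (G.comap ι).copyCount F ≤ G.copyCount F := by
  rw [← copyCount_map hF ι]
  exact copyCount_mono hF (SimpleGraph.map_comap_le ι G)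

/-- An assignment `f` of layers to the edges of `F` realises the placement `φ` of `F` if each edge
is present in its layer. -/
def Realises {m : ℕ} (K : Fin m → SimpleGraph V) (φ : W ↪ V) (f : F.edgeSet → Fin m) : Prop :=
  ∀ e, e.1.map φ ∈ (K (f e)).edgeSet

lemma map_le_iff_forall_edgeSet (φ : W ↪ V) (G : SimpleGraph V) :
    F.map φ ≤ G ↔ ∀ e : F.edgeSet, e.1.map φ ∈ G.edgeSet := by
  rw [← SimpleGraph.edgeSet_subset_edgeSet, SimpleGraph.edgeSet_map, Set.image_subset_iff]
  exact ⟨fun h e ↦ h e.2, fun h e he ↦ h ⟨e, he⟩⟩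

open Classical in
/-- The indicator that the placement `φ` of `F` appears in the union of the layers differs from
the number of layers that contain it by at most the number of ways to realise the placement with at
least two layers. -/
lemma abs_indicator_sub_sum_le [Finite W] [Fintype F.edgeSet] {m : ℕ} (K : Fin m → SimpleGraph V)
    (φ : W ↪ V) (he : 2 ≤ F.edgeSet.ncard) :
    |(if F.map φ ≤ ⨆ i, K i then 1 else 0 : ℝ) - ∑ i, (if F.map φ ≤ K i then 1 else 0 : ℝ)|
      ≤ ∑ f : F.edgeSet → Fin m with (∃ e e', f e ≠ f e'), (if Realises K φ f then 1 else 0 : ℝ) := by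
  obtain ⟨e₀, he₀, e₁, he₁, hne⟩ := (Set.one_lt_ncard (Set.toFinite _)).1 he
  rw [Finset.sum_boole, Finset.sum_boole, Finset.filter_filter]
  by_cases hk : ∃ i, F.map φ ≤ K i
  · obtain ⟨i, hi⟩ := hk
    rw [if_pos (hi.trans (le_iSup K i))]
    set S : Finset (Fin m) := Finset.univ.filter fun i ↦ F.map φ ≤ K i
    have hiS : i ∈ S := by simp [S, hi]
    have h1 : 1 ≤ S.card := Finset.card_pos.2 ⟨i, hiS⟩
    -- For each further layer `j` that contains the placement, move the edge `e₀` from `i` to `j`.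
    have h2 : (S.erase i).card ≤ (Finset.univ.filter fun f : F.edgeSet → Fin m ↦
        (∃ e e', f e ≠ f e') ∧ Realises K φ f).card := by
      refine Finset.card_le_card_of_injOn
        (fun j ↦ Function.update (fun _ ↦ i) (⟨e₀, he₀⟩ : F.edgeSet) j) ?_ ?_
      · intro j hj
        obtain ⟨hji, hj⟩ := Finset.mem_erase.1 hj
        have hj : F.map φ ≤ K j := by simpa [S] using hj
        simp only [Finset.coe_filter, Finset.mem_univ, true_and, Set.mem_ofPred_eq]
        refine ⟨⟨⟨e₀, he₀⟩, ⟨e₁, he₁⟩, ?_⟩, fun e ↦ ?_⟩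
        · rw [Function.update_self, Function.update_of_ne (by simpa using hne.symm)]
          exact hji
        · by_cases h : e = ⟨e₀, he₀⟩
          · subst h
            rw [Function.update_self]
            exact (map_le_iff_forall_edgeSet φ _).1 hj _
          · rw [Function.update_of_ne h]
            exact (map_le_iff_forall_edgeSet φ _).1 hi _
      · intro j _ j' _ h
        simpa using congrFun h ⟨e₀, he₀⟩
    rw [Finset.card_erase_of_mem hiS] at h2
    rw [abs_sub_comm, abs_of_nonneg (by simpa using h1)]
    have h3 : ((S.card - 1 : ℕ) : ℝ) ≤ _ := Nat.cast_le.2 h2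
    rwa [Nat.cast_sub h1, Nat.cast_one] at h3
  · push Not at hk
    have h0 : (Finset.univ.filter fun i ↦ F.map φ ≤ K i) = ∅ := by
      simpa [Finset.filter_eq_empty_iff] using hk
    rw [h0, Finset.card_empty, Nat.cast_zero, sub_zero]
    split_ifs with h
    · rw [abs_one, Nat.one_le_cast, Finset.one_le_card]
      have h' := (map_le_iff_forall_edgeSet φ _).1 h
      simp only [SimpleGraph.edgeSet_iSup, Set.mem_iUnion] at h'
      choose f hf using h'
      refine ⟨f, ?_⟩
      simp only [Finset.mem_filter, Finset.mem_univ, true_and]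
      refine ⟨?_, hf⟩
      by_contra! hconst
      refine hk (f ⟨e₀, he₀⟩) ((map_le_iff_forall_edgeSet φ _).2 fun e ↦ ?_)
      rw [hconst ⟨e₀, he₀⟩ e]
      exact hf e
    · simp

open Classical in
/-- The number of copies of `F` in a union of layers differs from the sum of the numbers of copies
in the single layers by at most the number of realisations of placements of `F` that use at least
two layers. -/
lemma abs_copyCount_iSup_sub_sum_le [Fintype V] [Fintype W] [Fintype F.edgeSet]
    (hF : F.support = Set.univ) (he : 2 ≤ F.edgeSet.ncard) {m : ℕ} (K : Fin m → SimpleGraph V) :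
    |((⨆ i, K i).copyCount F : ℝ) - ∑ i, ((K i).copyCount F : ℝ)|
      ≤ ∑ φ : W ↪ V, ∑ f : F.edgeSet → Fin m with (∃ e e', f e ≠ f e'),
          (if Realises K φ f then 1 else 0 : ℝ) := by
  set C : Finset (SimpleGraph V) := Finset.univ.image fun φ : W ↪ V ↦ F.map φ
  have hcount : ∀ G : SimpleGraph V, (G.copyCount F : ℝ) = ∑ H ∈ C, if H ≤ G then 1 else 0 := by
    intro G
    rw [copyCount_eq_ncard hF, Finset.sum_boole, ← Set.ncard_coe_finset]
    congr 2
    ext H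
    simp [C]
  simp only [hcount]
  rw [Finset.sum_comm, ← Finset.sum_sub_distrib]
  refine (Finset.abs_sum_le_sum_abs _ _).trans ?_
  calc ∑ H ∈ C, |(if H ≤ ⨆ i, K i then 1 else 0 : ℝ) - ∑ i, (if H ≤ K i then 1 else 0 : ℝ)|
      ≤ ∑ φ : W ↪ V, |(if F.map φ ≤ ⨆ i, K i then 1 else 0 : ℝ)
          - ∑ i, (if F.map φ ≤ K i then 1 else 0 : ℝ)| := by
        exact Finset.sum_image_le_of_nonneg fun _ _ ↦ abs_nonneg _
    _ ≤ _ := Finset.sum_le_sum fun φ _ ↦ abs_indicator_sub_sum_le K φ he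

end

/-! ### The rank of a graph -/

section

/-- The incidence vector over `𝔽₂` of a pair of vertices. -/
noncomputable def edgeVec {W : Type*} (e : Sym2 W) : W → ZMod 2 := by
  classical exact fun w ↦ if w ∈ e then 1 else 0

/-- The column space of the incidence matrix of `H` over `𝔽₂`: the span of the incidence vectors of
the edges. -/
noncomputable def edgeSpan {W : Type*} (H : SimpleGraph W) : Submodule (ZMod 2) (W → ZMod 2) :=
  Submodule.span (ZMod 2) (edgeVec '' H.edgeSet)

/-- The rank of the edge set of `H` in the graphic matroid, that is, the number of vertices minus the
number of connected components (isolated vertices included). It is encoded as the dimension of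
`edgeSpan H`. -/
noncomputable def rank {W : Type*} (H : SimpleGraph W) : ℕ := Module.finrank (ZMod 2) (edgeSpan H)

variable {W : Type*}

lemma edgeVec_mk [DecidableEq W] {a b : W} (h : a ≠ b) :
    edgeVec s(a, b) = Pi.single a 1 + Pi.single b 1 := by
  classical
  ext w
  by_cases ha : w = a
  · subst ha; simp [edgeVec, h]
  · by_cases hb : w = b
    · subst hb; simp [edgeVec, ha]
    · simp [edgeVec, ha, hb]

lemma single_add_single_mem_edgeSpan [DecidableEq W] {H : SimpleGraph W} {a b : W} (h : H.Adj a b) :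
    (Pi.single a 1 + Pi.single b 1 : W → ZMod 2) ∈ edgeSpan H := by
  rw [← edgeVec_mk h.ne]
  exact Submodule.subset_span ⟨_, h, rfl⟩

lemma edgeSpan_mono {H H' : SimpleGraph W} (h : H ≤ H') : edgeSpan H ≤ edgeSpan H' :=
  Submodule.span_mono (Set.image_mono (SimpleGraph.edgeSet_mono h))

lemma edgeSpan_sup (H H' : SimpleGraph W) : edgeSpan (H ⊔ H') = edgeSpan H ⊔ edgeSpan H' := by
  simp [edgeSpan, SimpleGraph.edgeSet_sup, Set.image_union, Submodule.span_union]

variable [Fintype W]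

omit [Fintype W] in
lemma rank_bot : rank (⊥ : SimpleGraph W) = 0 := by
  have h : edgeSpan (⊥ : SimpleGraph W) = ⊥ := by simp [edgeSpan]
  unfold rank
  rw [h, finrank_bot]

lemma rank_le_ncard_edgeSet (H : SimpleGraph W) : rank H ≤ H.edgeSet.ncard := by
  classical
  unfold rank edgeSpan
  refine (finrank_span_le_card _).trans ?_
  rw [← Set.ncard_eq_toFinset_card']
  exact Set.ncard_image_le

lemma one_le_rank {H : SimpleGraph W} (hH : H ≠ ⊥) : 1 ≤ rank H := by
  classical
  obtain ⟨a, b, hab⟩ := SimpleGraph.ne_bot_iff_exists_adj.1 hH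
  refine Submodule.one_le_finrank_iff.2 fun h ↦ ?_
  have := single_add_single_mem_edgeSpan hab
  rw [h, Submodule.mem_bot] at this
  simpa [hab.ne] using congrFun this a

/-- A nonempty graph has rank less than the number of its non-isolated vertices: the edge vectors
have even weight, unlike the unit vectors. -/
lemma rank_lt_ncard_support {H : SimpleGraph W} (hH : H ≠ ⊥) : rank H < H.support.ncard := by
  classical
  obtain ⟨a, b, hab⟩ := SimpleGraph.ne_bot_iff_exists_adj.1 hH
  set S : Submodule (ZMod 2) (W → ZMod 2) :=
    Submodule.span (ZMod 2) ((fun w ↦ Pi.single w 1) '' H.support)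
  have hle : edgeSpan H ≤ S := by
    refine Submodule.span_le.2 ?_
    rintro _ ⟨e, he, rfl⟩
    induction e with
    | _ u v =>
      have huv : H.Adj u v := he
      rw [edgeVec_mk huv.ne]
      exact S.add_mem (Submodule.subset_span ⟨u, ⟨v, huv⟩, rfl⟩)
        (Submodule.subset_span ⟨v, ⟨u, huv.symm⟩, rfl⟩)
  have hlt : edgeSpan H < S := by
    refine lt_of_le_of_ne hle fun h ↦ ?_
    have ha : (Pi.single a 1 : W → ZMod 2) ∈ edgeSpan H := by
      rw [h]
      exact Submodule.subset_span ⟨a, ⟨b, hab⟩, rfl⟩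
    have hsum : edgeSpan H ≤ LinearMap.ker (∑ w, LinearMap.proj w : (W → ZMod 2) →ₗ[ZMod 2] ZMod 2)
        := by
      refine Submodule.span_le.2 ?_
      rintro _ ⟨e, he, rfl⟩
      induction e with
      | _ u v =>
        have huv : H.Adj u v := he
        rw [edgeVec_mk huv.ne]
        simp only [SetLike.mem_coe, LinearMap.mem_ker, LinearMap.coe_sum, Finset.sum_apply,
          LinearMap.coe_proj, Function.eval, Pi.add_apply, Finset.sum_add_distrib,
          Finset.sum_pi_single', Finset.mem_univ, if_true]
        decide
    have := hsum ha
    simp [LinearMap.mem_ker] at this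
  calc rank H < Module.finrank (ZMod 2) S := Submodule.finrank_lt_finrank_of_lt hlt
    _ ≤ _ := by
      refine (finrank_span_le_card _).trans ?_
      rw [← Set.ncard_eq_toFinset_card']
      exact Set.ncard_image_le

lemma card_le_rank_add_one {F : SimpleGraph W} (hF : F.Connected) :
    Fintype.card W ≤ rank F + 1 := by
  classical
  obtain ⟨a⟩ := hF.nonempty
  have hspan : edgeSpan F ⊔ Submodule.span (ZMod 2) {Pi.single a 1} = ⊤ := by
    rw [eq_top_iff, ← (Pi.basisFun (ZMod 2) W).span_eq]
    refine Submodule.span_le.2 ?_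
    rintro _ ⟨w, rfl⟩
    rw [Pi.basisFun_apply]
    have key : ∀ w, F.Reachable a w → (Pi.single w 1 : W → ZMod 2) ∈
        edgeSpan F ⊔ Submodule.span (ZMod 2) {Pi.single a 1} := by
      intro w hw
      rw [SimpleGraph.reachable_iff_reflTransGen] at hw
      induction hw with
      | refl => exact Submodule.mem_sup_right (Submodule.mem_span_singleton_self _)
      | tail _ h ih =>
        have := Submodule.add_mem _ ih
          (Submodule.mem_sup_left (T := Submodule.span (ZMod 2) {Pi.single a 1})
            (single_add_single_mem_edgeSpan h))
        rwa [← add_assoc, ZModModule.add_self, zero_add] at this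
    exact key w (hF.preconnected a w)
  have := Submodule.finrank_add_le_finrank_add_finrank (edgeSpan F)
    (Submodule.span (ZMod 2) {(Pi.single a 1 : W → ZMod 2)})
  rw [hspan, finrank_top, Module.finrank_fintype_fun_eq_card] at this
  exact this.trans (Nat.add_le_add_left
    (finrank_span_singleton (K := ZMod 2) (v := (Pi.single a 1 : W → ZMod 2)) (by simp)).le _)

omit [Fintype W] in
/-- In a connected graph whose edges are split into two nonempty classes, some vertex is incident
with both classes. -/
lemma exists_adj_adj {F A B : SimpleGraph W} (hF : F.Connected) (hAB : F = A ⊔ B)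
    (hA : A ≠ ⊥) (hB : B ≠ ⊥) : ∃ w a b, A.Adj w a ∧ B.Adj w b := by
  by_contra! h
  obtain ⟨a, b, hab⟩ := SimpleGraph.ne_bot_iff_exists_adj.1 hA
  obtain ⟨c, d, hcd⟩ := SimpleGraph.ne_bot_iff_exists_adj.1 hB
  have key : ∀ w, F.Reachable a w → ∃ u, A.Adj w u := by
    intro w hw
    rw [SimpleGraph.reachable_iff_reflTransGen] at hw
    induction hw with
    | refl => exact ⟨b, hab⟩
    | @tail x y _ hxy ih =>
      obtain ⟨u, hu⟩ := ih
      rw [hAB, SimpleGraph.sup_adj] at hxy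
      rcases hxy with hxy | hxy
      · exact ⟨x, hxy.symm⟩
      · exact absurd hxy (h x u y hu)
  obtain ⟨u, hu⟩ := key c (hF.preconnected a c)
  exact h c u d hu hcd

/-- The graphic matroid of a 2-connected graph is connected: if the edges are split into two
nonempty classes, then the ranks of the classes add up to more than the rank of the graph. -/
lemma card_le_rank_add_rank {F A B : SimpleGraph W} (hF : TwoConnected F) (hAB : F = A ⊔ B)
    (hA : A ≠ ⊥) (hB : B ≠ ⊥) : Fintype.card W ≤ rank A + rank B := by
  classical
  obtain ⟨w, a, b, hwa, hwb⟩ := exists_adj_adj hF.1 hAB hA hB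
  -- Along a path from `a` to `b` that avoids `w`, split the sum of the edge vectors by class.
  have key : ∀ u v : ({w}ᶜ : Set W), (F.induce {w}ᶜ).Reachable u v →
      ∃ x ∈ edgeSpan A, ∃ y ∈ edgeSpan B, x w = 0 ∧ y w = 0 ∧
        (Pi.single u.1 1 + Pi.single v.1 1 : W → ZMod 2) = x + y := by
    intro u v huv
    rw [SimpleGraph.reachable_iff_reflTransGen] at huv
    induction huv with
    | refl => exact ⟨0, zero_mem _, 0, zero_mem _, rfl, rfl, by
        rw [ZModModule.add_self, add_zero]⟩
    | @tail c d _ hcd ih =>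
      obtain ⟨x, hx, y, hy, hx0, hy0, hxy⟩ := ih
      have hcd' : A.Adj c.1 d.1 ∨ B.Adj c.1 d.1 := by
        have : F.Adj c.1 d.1 := hcd
        rwa [hAB] at this
      have hc : w ≠ c.1 := fun h ↦ c.2 h.symm
      have hd : w ≠ d.1 := fun h ↦ d.2 h.symm
      have heq : (Pi.single u.1 1 + Pi.single d.1 1 : W → ZMod 2)
          = x + y + (Pi.single c.1 1 + Pi.single d.1 1) := by
        linear_combination hxy - ZModModule.add_self (Pi.single c.1 1 : W → ZMod 2)
      rcases hcd' with hcd' | hcd'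
      · exact ⟨x + (Pi.single c.1 1 + Pi.single d.1 1),
          add_mem hx (single_add_single_mem_edgeSpan hcd'), y, hy, by simp [hx0, hc, hd], hy0,
          by rw [heq]; abel⟩
      · exact ⟨x, hx, y + (Pi.single c.1 1 + Pi.single d.1 1),
          add_mem hy (single_add_single_mem_edgeSpan hcd'), hx0, by simp [hy0, hc, hd],
          by rw [heq]; abel⟩
  obtain ⟨x, hx, y, hy, hx0, hy0, hxy⟩ := key ⟨a, hwa.ne'⟩ ⟨b, hwb.ne'⟩ ((hF.2 w).preconnected _ _)
  -- Closing the path up with the edges `wa` and `wb` gives a cycle; the sum of its edge vectors in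
  -- `A` lies in both spaces, and it is nonzero at `w`.
  have hinf : 1 ≤ Module.finrank (ZMod 2) (edgeSpan A ⊓ edgeSpan B : Submodule _ _) := by
    refine Submodule.one_le_finrank_iff.2 fun h ↦ ?_
    have hmem : (Pi.single w 1 + Pi.single a 1 + x : W → ZMod 2) ∈ edgeSpan A ⊓ edgeSpan B := by
      refine ⟨add_mem (single_add_single_mem_edgeSpan hwa) hx, ?_⟩
      have : (Pi.single w 1 + Pi.single a 1 + x : W → ZMod 2)
          = Pi.single w 1 + Pi.single b 1 + y := by
        linear_combination hxy + ZModModule.add_self x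
          - ZModModule.add_self (Pi.single b 1 : W → ZMod 2)
      rw [this]
      exact add_mem (single_add_single_mem_edgeSpan hwb) hy
    rw [h, Submodule.mem_bot] at hmem
    simpa [hx0, hwa.ne] using congrFun hmem w
  have h1 := Submodule.finrank_sup_add_finrank_inf_eq (edgeSpan A) (edgeSpan B)
  rw [← edgeSpan_sup, ← hAB] at h1
  have h2 := card_le_rank_add_one hF.1
  unfold rank at *
  omega

lemma rank_mono {A B : SimpleGraph W} (h : A ≤ B) : rank A ≤ rank B :=
  Submodule.finrank_mono (edgeSpan_mono h)

lemma rank_sup_le (A B : SimpleGraph W) : rank (A ⊔ B) ≤ rank A + rank B := by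
  unfold rank
  rw [edgeSpan_sup]
  exact Submodule.finrank_add_le_finrank_add_finrank _ _

lemma rank_le_sum_of_forall_adj {ι : Type*} (s : Finset ι) (A : ι → SimpleGraph W)
    (H : SimpleGraph W) (h : ∀ a b, H.Adj a b → ∃ i ∈ s, (A i).Adj a b) :
    rank H ≤ ∑ i ∈ s, rank (A i) := by
  classical
  induction s using Finset.induction_on generalizing H with
  | empty =>
    have hH : H = ⊥ := by
      ext a b
      simpa using h a b
    rw [hH, rank_bot]
    exact Nat.zero_le _
  | insert i s hi ih =>
    rw [Finset.sum_insert hi]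
    refine (rank_mono (B := A i ⊔ H \ A i) (by simp)).trans ((rank_sup_le _ _).trans ?_)
    refine Nat.add_le_add_left (ih _ fun a b hab ↦ ?_) _
    obtain ⟨j, hj, hj'⟩ := h a b hab.1
    rcases Finset.mem_insert.1 hj with rfl | hj
    · exact absurd hj' hab.2
    · exact ⟨j, hj, hj'⟩

/-! ### Edge colourings of a 2-connected graph -/

/-- The graph formed by the edges of colour `i` in an edge colouring `f` of `F`. -/
def colourClass {F : SimpleGraph W} {ι : Type*} (f : F.edgeSet → ι) (i : ι) : SimpleGraph W where
  Adj a b := ∃ h : F.Adj a b, f ⟨s(a, b), h⟩ = i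
  symm := ⟨fun a b ⟨h, hi⟩ ↦ ⟨h.symm, by rw [← hi]; congr 2; exact Sym2.eq_swap⟩⟩
  loopless := ⟨fun _ ⟨h, _⟩ ↦ h.ne rfl⟩

omit [Fintype W] in
lemma edgeSet_colourClass {F : SimpleGraph W} {ι : Type*} (f : F.edgeSet → ι) (i : ι) :
    (colourClass f i).edgeSet = Subtype.val '' (f ⁻¹' {i}) := by
  ext e
  induction e with
  | _ a b =>
    simp only [SimpleGraph.mem_edgeSet, Set.mem_image, Set.mem_preimage, Set.mem_singleton_iff,
      Subtype.exists, exists_and_right, exists_eq_right]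
    rfl

omit [Fintype W] in
lemma colourClass_ne_bot {F : SimpleGraph W} {ι : Type*} (f : F.edgeSet → ι) (e : F.edgeSet) :
    colourClass f (f e) ≠ ⊥ := by
  rw [← SimpleGraph.edgeSet_nonempty, edgeSet_colourClass]
  exact ⟨e, e, rfl, rfl⟩

lemma sum_rank_colourClass_le {F : SimpleGraph W} {ι : Type*} [DecidableEq ι] [Fintype F.edgeSet]
    (f : F.edgeSet → ι) :
    ∑ i ∈ Finset.univ.image f, rank (colourClass f i) ≤ F.edgeSet.ncard := by
  calc ∑ i ∈ Finset.univ.image f, rank (colourClass f i)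
      ≤ ∑ i ∈ Finset.univ.image f, (Finset.univ.filter fun e ↦ f e = i).card := by
        refine Finset.sum_le_sum fun i _ ↦ (rank_le_ncard_edgeSet _).trans ?_
        rw [edgeSet_colourClass, Set.ncard_image_of_injective _ Subtype.val_injective,
          ← Set.ncard_coe_finset]
        refine (congrArg Set.ncard ?_).le
        ext e
        simp
    _ = F.edgeSet.ncard := by
        rw [← Finset.card_eq_sum_card_image, Finset.card_univ, ← Nat.card_coe_set_eq,
          Nat.card_eq_fintype_card]

/-- If the edges of a 2-connected graph are coloured with more than one colour, then the ranks of
the colour classes add up to at least the number of vertices. -/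
lemma card_le_sum_rank_colourClass {F : SimpleGraph W} (hF : TwoConnected F) {ι : Type*}
    [DecidableEq ι] [Fintype F.edgeSet] (f : F.edgeSet → ι) (hf : ∃ e e', f e ≠ f e') :
    Fintype.card W ≤ ∑ i ∈ Finset.univ.image f, rank (colourClass f i) := by
  obtain ⟨e, e', hee'⟩ := hf
  set A := colourClass f (f e)
  have hA : A ≤ F := fun _ _ h ↦ h.1
  have hB : F \ A ≠ ⊥ := by
    refine ne_bot_of_le_ne_bot (colourClass_ne_bot f e') fun a b h ↦ ?_
    exact ⟨h.1, fun h' ↦ hee' (h'.2.symm.trans h.2)⟩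
  have h1 := card_le_rank_add_rank hF (by simp [hA] : F = A ⊔ F \ A) (colourClass_ne_bot f e) hB
  refine h1.trans ?_
  rw [← Finset.add_sum_erase _ _ (Finset.mem_image_of_mem f (Finset.mem_univ e))]
  refine Nat.add_le_add_left (rank_le_sum_of_forall_adj _ _ _ fun a b hab ↦ ?_) _
  exact ⟨f ⟨s(a, b), hab.1⟩, Finset.mem_erase.2 ⟨fun h ↦ hab.2 ⟨hab.1, h⟩,
    Finset.mem_image_of_mem f (Finset.mem_univ _)⟩, hab.1, rfl⟩

end

/-! ### The probability that a layer contains a given graph -/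

section

/-- A form of `C(n - s, k - s) / C(n, k) ≤ (k / n) ^ s` without division. -/
lemma choose_sub_mul_pow_le {n k : ℕ} (hk : k ≤ n) (s : ℕ) (hs : s ≤ k) :
    (n - s).choose (k - s) * n ^ s ≤ n.choose k * k ^ s := by
  induction s with
  | zero => simp
  | succ s ih =>
    have h1 : (n - s).choose (k - s) * (k - s) = (n - s) * (n - (s + 1)).choose (k - (s + 1)) := by
      have := Nat.add_one_mul_choose_eq (n - (s + 1)) (k - (s + 1))
      rw [show n - (s + 1) + 1 = n - s by omega, show k - (s + 1) + 1 = k - s by omega] at this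
      exact this.symm
    have h2 : (k - s) * n ≤ k * (n - s) := by
      zify [hk.trans' (by omega : s ≤ k), (by omega : s ≤ k)]
      nlinarith
    have h3 : 0 < n - s := by omega
    refine Nat.le_of_mul_le_mul_left ?_ h3
    calc (n - s) * ((n - (s + 1)).choose (k - (s + 1)) * n ^ (s + 1))
        = ((n - s).choose (k - s) * n ^ s) * ((k - s) * n) := by
          rw [← mul_assoc, ← h1]
          ring
      _ ≤ (n.choose k * k ^ s) * (k * (n - s)) := Nat.mul_le_mul (ih (by omega)) h2
      _ = _ := by ring

/-- A uniformly random `k`-subset of an `n`-set contains a given `s`-subset with probability at most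
`(k / n) ^ s`. -/
lemma uniformOn_card_eq_le {n k : ℕ} (hk : k ≤ n) (S : Finset (Fin n)) :
    uniformOn {V : Finset (Fin n) | V.card = k} {V | S ⊆ V}
      ≤ ENNReal.ofReal (((k : ℝ) / n) ^ S.card) := by
  classical
  have h1 : {V : Finset (Fin n) | V.card = k}
      = (Finset.powersetCard k (Finset.univ : Finset (Fin n)) : Set (Finset (Fin n))) := by
    ext V; simp [Finset.mem_powersetCard]
  have h2 : {V : Finset (Fin n) | S ⊆ V}
      = (Finset.univ.filter (fun V ↦ S ⊆ V) : Finset (Finset (Fin n))) := by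
    ext V; simp
  rw [h1, h2, uniformOn_apply_finset, Finset.card_powersetCard, Finset.card_univ, Fintype.card_fin]
  by_cases hs : S.card ≤ k
  · have hcard : (Finset.powersetCard k (Finset.univ : Finset (Fin n))
        ∩ Finset.univ.filter (fun V ↦ S ⊆ V)).card ≤ (n - S.card).choose (k - S.card) := by
      have hc : (Finset.powersetCard (k - S.card) Sᶜ).card = (n - S.card).choose (k - S.card) := by
        rw [Finset.card_powersetCard, Finset.card_compl, Fintype.card_fin]
      rw [← hc]
      refine (Finset.card_le_card fun V hV ↦ ?_).trans
        (Finset.card_image_le (f := fun V ↦ V ∪ S))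
      simp only [Finset.mem_inter, Finset.mem_powersetCard, Finset.mem_filter, Finset.mem_univ,
        true_and, Finset.subset_univ] at hV
      refine Finset.mem_image.2 ⟨V \ S, Finset.mem_powersetCard.2 ⟨?_, ?_⟩, ?_⟩
      · intro x hx
        exact Finset.mem_compl.2 (Finset.mem_sdiff.1 hx).2
      · rw [Finset.card_sdiff_of_subset hV.2, hV.1]
      · exact Finset.sdiff_union_of_subset hV.2
    have hpos : (0 : ℝ) < n.choose k := by exact_mod_cast Nat.choose_pos hk
    refine (ENNReal.div_le_div_right (Nat.cast_le.2 hcard) _).trans ?_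
    rw [← ENNReal.ofReal_natCast, ← ENNReal.ofReal_natCast (n.choose k),
      ← ENNReal.ofReal_div_of_pos hpos]
    refine ENNReal.ofReal_le_ofReal ?_
    rcases Nat.eq_zero_or_pos S.card with h0 | h0
    · simp only [h0, Nat.sub_zero, pow_zero]
      exact div_self_le_one _
    have hn : (0 : ℝ) < n := by exact_mod_cast (by omega : 0 < n)
    rw [div_pow, div_le_div_iff₀ hpos (by positivity)]
    exact_mod_cast (choose_sub_mul_pow_le hk S.card hs).trans_eq (mul_comm _ _)
  · have hempty : Finset.powersetCard k (Finset.univ : Finset (Fin n))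
        ∩ Finset.univ.filter (fun V ↦ S ⊆ V) = ∅ := by
      ext V
      simp only [Finset.mem_inter, Finset.mem_powersetCard, Finset.mem_filter, Finset.mem_univ,
        true_and, Finset.subset_univ, Finset.notMem_empty, iff_false, not_and]
      intro hV hSV
      exact hs (hV ▸ Finset.card_le_card hSV)
    simp [hempty]

/-- Given its parameters and its vertex set `V`, a layer contains `H` with probability
`q ^ |E(H)|` if the non-isolated vertices of `H` lie in `V`, and with probability zero otherwise. -/
lemma edgeKernel_setOf_le_le {n : ℕ} (a : ℕ × I) (V : Finset (Fin n)) (H : SimpleGraph (Fin n)) :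
    edgeKernel n (a, V) {G | H ≤ G}
      ≤ {V : Finset (Fin n) | H.support ⊆ V}.indicator
          (fun _ ↦ ENNReal.ofReal ((a.2 : ℝ) ^ H.edgeSet.ncard)) V := by
  classical
  have hm : Measurable (SimpleGraph.map (Subtype.val : V → Fin n)) :=
    fun _ _ ↦ (Set.toFinite _).measurableSet
  change (SimpleGraph.binomialRandom V a.2).map (SimpleGraph.map (Subtype.val : V → Fin n)) _ ≤ _
  rw [Measure.map_apply hm (Set.toFinite _).measurableSet]
  set ι : V ↪ Fin n := Function.Embedding.subtype _
  by_cases hV : H.support ⊆ V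
  · rw [Set.indicator_of_mem (by exact hV)]
    have hH : (H.comap ι).map ι = H := by
      refine le_antisymm (SimpleGraph.map_comap_le ι H) fun u v huv ↦ ?_
      rw [SimpleGraph.map_adj]
      exact ⟨⟨u, hV ⟨v, huv⟩⟩, ⟨v, hV ⟨u, huv.symm⟩⟩, huv, rfl, rfl⟩
    have hset : SimpleGraph.map (Subtype.val : V → Fin n) ⁻¹' {G | H ≤ G}
        = {G | H.comap ι ≤ G} := by
      ext G
      simp only [Set.mem_preimage, Set.mem_ofPred_eq]
      conv_lhs => rw [← hH]
      change (H.comap ι).map ι ≤ G.map ι ↔ _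
      rw [SimpleGraph.map_le_iff_le_comap, SimpleGraph.comap_map_eq]
    have hc : (H.comap ι).edgeSet.ncard = H.edgeSet.ncard := by
      conv_rhs => rw [← hH, SimpleGraph.edgeSet_map,
        Set.ncard_image_of_injective _ ι.sym2Map.injective]
    rw [hset, binomialRandom_setOf_le, hc, ENNReal.ofReal_pow a.2.2.1]
    refine (congrArg (· ^ H.edgeSet.ncard) ?_).le
    rw [ENNReal.ofReal]
    congr 1
    ext
    simp [unitInterval.toNNReal, a.2.2.1]
    rfl
  · rw [Set.indicator_of_notMem (by exact hV)]
    refine (measure_mono_null (t := ∅) (fun G hG ↦ ?_) measure_empty).le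
    refine hV fun u hu ↦ ?_
    obtain ⟨v, huv⟩ := hu
    obtain ⟨u', v', _, hu', _⟩ := (SimpleGraph.map_adj ι G _ _).1 (hG huv)
    rw [← hu']
    exact u'.2

/-- The density `((x ∧ n) / n) ^ (s + 1) q ^ s` that bounds the conditional probability that a layer
contains a given graph of rank `s`, given `(X, Q) = (x, q)`. -/
noncomputable def containDensity (n s : ℕ) (a : ℕ × I) : ℝ :=
  (((min a.1 n : ℕ) : ℝ) / n) ^ (s + 1) * (a.2 : ℝ) ^ s

lemma containDensity_nonneg (n s : ℕ) (a : ℕ × I) : 0 ≤ containDensity n s a :=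
  mul_nonneg (by positivity) (pow_nonneg a.2.2.1 _)

lemma min_div_le_one (x n : ℕ) : (((min x n : ℕ) : ℝ) / n) ≤ 1 :=
  div_le_one_of_le₀ (by exact_mod_cast min_le_right x n) (by positivity)

lemma containDensity_le_one (n s : ℕ) (a : ℕ × I) : containDensity n s a ≤ 1 :=
  mul_le_one₀ (pow_le_one₀ (by positivity) (min_div_le_one _ _)) (pow_nonneg a.2.2.1 _)
    (pow_le_one₀ a.2.2.1 a.2.2.2)

lemma measurable_containDensity (n s : ℕ) : Measurable (containDensity n s) := by
  unfold containDensity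
  have h1 : Measurable fun a : ℕ × I ↦ ((min a.1 n : ℕ) : ℝ) :=
    (measurable_of_countable fun x : ℕ ↦ ((min x n : ℕ) : ℝ)).comp measurable_fst
  have h2 : Measurable fun a : ℕ × I ↦ (a.2 : ℝ) := measurable_subtype_coe.comp measurable_snd
  fun_prop

lemma integrable_containDensity (μ : Measure (ℕ × I)) [IsProbabilityMeasure μ] (n s : ℕ) :
    Integrable (containDensity n s) μ :=
  Integrable.of_bound (measurable_containDensity n s).aestronglyMeasurable 1
    (ae_of_all _ fun a ↦ by
      rw [Real.norm_of_nonneg (containDensity_nonneg n s a)]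
      exact containDensity_le_one n s a)

/-- A layer contains a given nonempty graph of rank `s` with probability at most
`E[((X ∧ n) / n) ^ (s + 1) Q ^ s]`, because such a graph has at least `s + 1` non-isolated vertices
and at least `s` edges. -/
lemma layerLaw_real_setOf_map_le (μ : Measure (ℕ × I)) [IsProbabilityMeasure μ] {W : Type*}
    [Fintype W] {n : ℕ} (H : SimpleGraph W) (hH : H ≠ ⊥) (φ : W ↪ Fin n) :
    (layerLaw μ n).real {ω | H.map φ ≤ ω.2.2} ≤ ∫ a, containDensity n (rank H) a ∂μ := by
  classical
  have hmeas : MeasurableSet {ω : Layer n | H.map φ ≤ ω.2.2} :=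
    (measurable_snd.comp measurable_snd) (Set.toFinite {G | H.map φ ≤ G}).measurableSet
  refine ENNReal.toReal_le_of_le_ofReal (integral_nonneg fun a ↦ containDensity_nonneg _ _ a) ?_
  rw [ofReal_integral_eq_lintegral_ofReal (integrable_containDensity μ n _)
    (ae_of_all _ fun a ↦ containDensity_nonneg _ _ a)]
  unfold layerLaw
  rw [Measure.compProd_apply hmeas]
  refine lintegral_mono fun a ↦ ?_
  rw [Kernel.compProd_apply (measurable_prodMk_left hmeas)]
  set S : Finset (Fin n) := (H.map φ).support.toFinset
  have hS : rank H + 1 ≤ S.card := by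
    rw [← Set.ncard_eq_toFinset_card', SimpleGraph.support_map,
      Set.ncard_image_of_injective _ φ.injective]
    exact rank_lt_ncard_support hH
  have hE : rank H ≤ (H.map φ).edgeSet.ncard := by
    rw [SimpleGraph.edgeSet_map, Set.ncard_image_of_injective _ φ.sym2Map.injective]
    exact rank_le_ncard_edgeSet H
  calc ∫⁻ V, edgeKernel n (a, V) (Prod.mk V ⁻¹' (Prod.mk a ⁻¹' {ω : Layer n | H.map φ ≤ ω.2.2}))
        ∂(vertexSetKernel n a)
      ≤ ∫⁻ V, {V : Finset (Fin n) | S ⊆ V}.indicator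
          (fun _ ↦ ENNReal.ofReal ((a.2 : ℝ) ^ (H.map φ).edgeSet.ncard)) V
          ∂(vertexSetKernel n a) := by
        refine lintegral_mono fun V ↦ (edgeKernel_setOf_le_le a V (H.map φ)).trans_eq ?_
        congr 1
        ext V
        simp [S]
    _ = ENNReal.ofReal ((a.2 : ℝ) ^ (H.map φ).edgeSet.ncard)
          * uniformOn {V : Finset (Fin n) | V.card = min a.1 n} {V | S ⊆ V} := by
        rw [lintegral_indicator_const (Set.toFinite _).measurableSet]
        rfl
    _ ≤ ENNReal.ofReal ((a.2 : ℝ) ^ (H.map φ).edgeSet.ncard)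
          * ENNReal.ofReal ((((min a.1 n : ℕ) : ℝ) / n) ^ S.card) := by
        gcongr
        exact uniformOn_card_eq_le (min_le_right _ _) S
    _ ≤ ENNReal.ofReal (containDensity n (rank H) a) := by
        rw [← ENNReal.ofReal_mul (pow_nonneg a.2.2.1 _), mul_comm]
        refine ENNReal.ofReal_le_ofReal (mul_le_mul ?_ ?_ (pow_nonneg a.2.2.1 _) (by positivity))
        · exact pow_le_pow_of_le_one (by positivity) (min_div_le_one _ _) hS
        · exact pow_le_pow_of_le_one a.2.2.1 a.2.2.2 hE

end

/-! ### The remainder: copies that use several layers -/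

section

/-- At most `m ^ r * |E| ^ |E|` functions from `E` to an `m`-set have an image of size `r`. With
weight `x ^ r` for each of them, where `m x ≤ D`, the sum over all functions is thus bounded
independently of `m`. -/
lemma sum_pow_card_image_le {E : Type*} [Fintype E] [DecidableEq E] (m : ℕ) {x D : ℝ} (hx : 0 ≤ x)
    (hD : 1 ≤ D) (hmx : m * x ≤ D) :
    ∑ f : E → Fin m, x ^ (Finset.univ.image f).card
      ≤ (Fintype.card E + 1) * ((Fintype.card E : ℝ) ^ Fintype.card E * D ^ Fintype.card E) := by
  classical
  set e := Fintype.card E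
  have hmaps : ∀ f ∈ (Finset.univ : Finset (E → Fin m)),
      Finset.univ.image f ∈ (Finset.univ : Finset (Finset (Fin m))).filter fun S ↦ S.card ≤ e := by
    intro f _
    simp only [Finset.mem_filter, Finset.mem_univ, true_and]
    exact Finset.card_image_le
  rw [← Finset.sum_fiberwise_of_maps_to hmaps]
  have hfib : ∀ S : Finset (Fin m), S.card ≤ e →
      ∑ f ∈ Finset.univ.filter (fun f : E → Fin m ↦ Finset.univ.image f = S),
        x ^ (Finset.univ.image f).card ≤ (e : ℝ) ^ e * x ^ S.card := by
    intro S hS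
    rw [Finset.sum_congr rfl (g := fun _ ↦ x ^ S.card)
      (fun f hf ↦ by rw [(Finset.mem_filter.1 hf).2]), Finset.sum_const, nsmul_eq_mul]
    refine mul_le_mul_of_nonneg_right ?_ (by positivity)
    have h1 : (Finset.univ.filter (fun f : E → Fin m ↦ Finset.univ.image f = S)).card
        ≤ S.card ^ e := by
      rw [← Fintype.card_piFinset_const S e, Fintype.card_piFinset_const]
      refine (Finset.card_le_card (t := Fintype.piFinset fun _ : E ↦ S) fun f hf ↦ ?_).trans_eq ?_
      · rw [Fintype.mem_piFinset]
        intro a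
        rw [← (Finset.mem_filter.1 hf).2]
        exact Finset.mem_image_of_mem f (Finset.mem_univ a)
      · simp [Fintype.card_piFinset, e]
    exact_mod_cast h1.trans (Nat.pow_le_pow_left hS e)
  refine (Finset.sum_le_sum fun S hS ↦ hfib S (Finset.mem_filter.1 hS).2).trans ?_
  have hmaps' : ∀ S ∈ (Finset.univ : Finset (Finset (Fin m))).filter (fun S ↦ S.card ≤ e),
      S.card ∈ Finset.range (e + 1) := by
    intro S hS
    simpa [Nat.lt_succ_iff] using hS
  rw [← Finset.sum_fiberwise_of_maps_to hmaps']
  have hr : ∀ r ∈ Finset.range (e + 1),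
      ∑ S ∈ ((Finset.univ : Finset (Finset (Fin m))).filter (fun S ↦ S.card ≤ e)).filter
        (fun S ↦ S.card = r), (e : ℝ) ^ e * x ^ S.card ≤ (e : ℝ) ^ e * D ^ e := by
    intro r hr
    rw [Finset.sum_congr rfl (g := fun _ ↦ (e : ℝ) ^ e * x ^ r)
      (fun f hf ↦ by rw [(Finset.mem_filter.1 hf).2]), Finset.sum_const, nsmul_eq_mul,
      mul_left_comm]
    refine mul_le_mul_of_nonneg_left ?_ (by positivity)
    have h1 : (((Finset.univ : Finset (Finset (Fin m))).filter (fun S ↦ S.card ≤ e)).filter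
        (fun S ↦ S.card = r)).card ≤ m ^ r := by
      refine (Finset.card_le_card (t := Finset.powersetCard r Finset.univ) fun S hS ↦ ?_).trans ?_
      · exact Finset.mem_powersetCard.2 ⟨Finset.subset_univ _, (Finset.mem_filter.1 hS).2⟩
      · rw [Finset.card_powersetCard, Finset.card_univ, Fintype.card_fin]
        exact Nat.choose_le_pow m r
    calc ((((Finset.univ : Finset (Finset (Fin m))).filter (fun S ↦ S.card ≤ e)).filter
        (fun S ↦ S.card = r)).card : ℝ) * x ^ r ≤ (m : ℝ) ^ r * x ^ r := by
          refine mul_le_mul_of_nonneg_right ?_ (by positivity)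
          exact_mod_cast h1
      _ = (m * x) ^ r := (mul_pow _ _ _).symm
      _ ≤ D ^ r := pow_le_pow_left₀ (by positivity) hmx r
      _ ≤ D ^ e := pow_le_pow_right₀ hD (Nat.lt_succ_iff.1 (Finset.mem_range.1 hr))
  refine (Finset.sum_le_sum hr).trans_eq ?_
  simp

/-- The moment conditions make the containment probabilities small: `E[((X ∧ n) / n) ^ (s + 1) Q ^ s]`
is of smaller order than `n ^ (-(1 + s θ))` if `X ^ (1 + s θ) Q ^ s` is integrable and `θ < 1`. -/
lemma tendsto_rpow_mul_integral_containDensity (μ : Measure (ℕ × I)) [IsProbabilityMeasure μ]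
    {s : ℕ} (hs : 1 ≤ s) {θ : ℝ} (hθ0 : 0 ≤ θ) (hθ : θ < 1)
    (hint : Integrable (fun a : ℕ × I ↦ (a.1 : ℝ) ^ (1 + (s : ℝ) * θ) * (a.2 : ℝ) ^ s) μ) :
    Tendsto (fun n : ℕ ↦ (n : ℝ) ^ (1 + (s : ℝ) * θ) * ∫ a, containDensity n s a ∂μ) atTop
      (𝓝 0) := by
  have hs' : (1 : ℝ) ≤ s := by exact_mod_cast hs
  have hexp : 0 < (s : ℝ) * (1 - θ) := by nlinarith
  have hid : ∀ n : ℕ, 1 ≤ n → ∀ a : ℕ × I, (n : ℝ) ^ (1 + (s : ℝ) * θ) * containDensity n s a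
      = ((min a.1 n : ℕ) : ℝ) ^ (s + 1) * (n : ℝ) ^ (-((s : ℝ) * (1 - θ))) * (a.2 : ℝ) ^ s := by
    intro n hn a
    have hn' : (0 : ℝ) < n := by exact_mod_cast hn
    have h1 : (n : ℝ) ^ (-((s : ℝ) * (1 - θ))) = (n : ℝ) ^ (1 + (s : ℝ) * θ) / (n : ℝ) ^ (s + 1) := by
      rw [← Real.rpow_natCast (n : ℝ) (s + 1), ← Real.rpow_sub hn']
      congr 1
      push_cast
      ring
    rw [h1, containDensity, div_pow]
    ring
  simp_rw [← integral_const_mul]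
  have h0 : (0 : ℝ) = ∫ _ : ℕ × I, (0 : ℝ) ∂μ := by simp
  rw [h0]
  refine tendsto_integral_filter_of_dominated_convergence _
    (Eventually.of_forall fun n ↦
      ((measurable_containDensity n s).const_mul _).aestronglyMeasurable) ?_ hint ?_
  · filter_upwards [eventually_ge_atTop 1] with n hn
    refine ae_of_all _ fun a ↦ ?_
    rw [hid n hn a, Real.norm_of_nonneg (mul_nonneg (by positivity) (pow_nonneg a.2.2.1 _))]
    refine mul_le_mul_of_nonneg_right ?_ (pow_nonneg a.2.2.1 _)
    have hn' : (0 : ℝ) < n := by exact_mod_cast hn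
    rcases Nat.eq_zero_or_pos (min a.1 n) with h | h
    · rw [h]
      simp only [Nat.cast_zero, ne_eq, Nat.add_eq_zero_iff, one_ne_zero, and_false,
        not_false_eq_true, zero_pow, zero_mul]
      positivity
    have hy : (0 : ℝ) < (min a.1 n : ℕ) := by exact_mod_cast h
    have hyn : ((min a.1 n : ℕ) : ℝ) ≤ n := by exact_mod_cast min_le_right _ _
    have hyx : ((min a.1 n : ℕ) : ℝ) ≤ a.1 := by exact_mod_cast min_le_left _ _
    calc ((min a.1 n : ℕ) : ℝ) ^ (s + 1) * (n : ℝ) ^ (-((s : ℝ) * (1 - θ)))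
        ≤ ((min a.1 n : ℕ) : ℝ) ^ (s + 1) * ((min a.1 n : ℕ) : ℝ) ^ (-((s : ℝ) * (1 - θ))) := by
          refine mul_le_mul_of_nonneg_left ?_ (by positivity)
          exact Real.rpow_le_rpow_of_nonpos hy hyn (by linarith)
      _ = ((min a.1 n : ℕ) : ℝ) ^ (1 + (s : ℝ) * θ) := by
          rw [← Real.rpow_natCast _ (s + 1), ← Real.rpow_add hy]
          congr 1
          push_cast
          ring
      _ ≤ (a.1 : ℝ) ^ (1 + (s : ℝ) * θ) := Real.rpow_le_rpow hy.le hyx (by positivity)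
  · refine ae_of_all _ fun a ↦ ?_
    have hlim : Tendsto (fun n : ℕ ↦ (a.1 : ℝ) ^ (s + 1) * (n : ℝ) ^ (-((s : ℝ) * (1 - θ)))
        * (a.2 : ℝ) ^ s) atTop (𝓝 0) := by
      have := ((tendsto_rpow_neg_atTop hexp).comp tendsto_natCast_atTop_atTop).const_mul
        ((a.1 : ℝ) ^ (s + 1)) |>.mul_const ((a.2 : ℝ) ^ s)
      simpa using this
    refine hlim.congr' ?_
    filter_upwards [eventually_ge_atTop (max 1 a.1)] with n hn
    rw [hid n (le_of_max_le_left hn) a, min_eq_left (le_of_max_le_right hn)]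

/-- The graphs of the layers. -/
def layerGraphs {n m : ℕ} (ω : Fin m → Layer n) (i : Fin m) : SimpleGraph (Fin n) := (ω i).2.2

lemma measurable_comp_layerGraphs {n m : ℕ} {α : Type*} [MeasurableSpace α]
    (g : (Fin m → SimpleGraph (Fin n)) → α) :
    Measurable fun ω : Fin m → Layer n ↦ g (layerGraphs ω) :=
  (Measurable.of_discrete (f := g)).comp
    (measurable_pi_lambda _ fun i ↦ (measurable_snd.comp measurable_snd).comp (measurable_pi_apply i))

lemma integrable_comp_layerGraphs (μ : Measure (ℕ × I)) [IsProbabilityMeasure μ] {n m : ℕ}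
    (g : (Fin m → SimpleGraph (Fin n)) → ℝ) :
    Integrable (fun ω : Fin m → Layer n ↦ g (layerGraphs ω)) (networkLaw μ n m) := by
  obtain ⟨C, hC⟩ := (Set.finite_range fun K ↦ ‖g K‖).bddAbove
  exact Integrable.of_bound (measurable_comp_layerGraphs g).aestronglyMeasurable C
    (ae_of_all _ fun ω ↦ hC ⟨layerGraphs ω, rfl⟩)

variable {W : Type*} [Fintype W] {F : SimpleGraph W}

omit [Fintype W] in
lemma realises_iff {V : Type*} {m : ℕ} (K : Fin m → SimpleGraph V) (φ : W ↪ V)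
    (f : F.edgeSet → Fin m) : Realises K φ f ↔ ∀ i, (colourClass f i).map φ ≤ K i := by
  have h : ∀ i, (colourClass f i).map φ ≤ K i ↔
      ∀ e : F.edgeSet, f e = i → e.1.map φ ∈ (K i).edgeSet := by
    intro i
    rw [← SimpleGraph.edgeSet_subset_edgeSet, SimpleGraph.edgeSet_map, Set.image_subset_iff,
      edgeSet_colourClass, Set.image_subset_iff]
    rfl
  simp only [h]
  exact ⟨fun hr i e he ↦ he ▸ hr e, fun hr e ↦ hr (f e) e rfl⟩

lemma networkLaw_real_realises_le (μ : Measure (ℕ × I)) [IsProbabilityMeasure μ] {n m : ℕ}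
    [Fintype F.edgeSet] (φ : W ↪ Fin n) (f : F.edgeSet → Fin m) :
    (networkLaw μ n m).real {ω | Realises (layerGraphs ω) φ f}
      ≤ ∏ i ∈ Finset.univ.image f, ∫ a, containDensity n (rank (colourClass f i)) a ∂μ := by
  classical
  have hset : {ω : Fin m → Layer n | Realises (layerGraphs ω) φ f}
      = Set.univ.pi fun i ↦ {ω : Layer n | (colourClass f i).map φ ≤ ω.2.2} := by
    ext ω
    simp only [Set.mem_ofPred_eq, realises_iff, Set.mem_univ_pi]
    rfl
  rw [hset, measureReal_def, networkLaw, Measure.pi_pi, ENNReal.toReal_prod,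
    ← Finset.prod_mul_prod_compl (Finset.univ.image f)]
  have h1 : ∏ i ∈ (Finset.univ.image f)ᶜ,
      (layerLaw μ n {ω : Layer n | (colourClass f i).map φ ≤ ω.2.2}).toReal ≤ 1 :=
    Finset.prod_le_one (fun _ _ ↦ ENNReal.toReal_nonneg) fun _ _ ↦ measureReal_le_one
  refine (mul_le_of_le_one_right (Finset.prod_nonneg fun _ _ ↦ ENNReal.toReal_nonneg) h1).trans ?_
  refine Finset.prod_le_prod (fun _ _ ↦ ENNReal.toReal_nonneg) fun i hi ↦ ?_
  obtain ⟨e, -, rfl⟩ := Finset.mem_image.1 hi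
  exact layerLaw_real_setOf_map_le μ _ (colourClass_ne_bot f e) φ

/-- A bound of order `ε √n` on the expected number of realisations of placements of `F` that use at
least two layers. The exponent of `n` comes from the ranks of the colour classes: they add up to at
least `v_F`, by 2-connectedness, and to at most `e_F`. -/
lemma sum_prod_integral_containDensity_le (μ : Measure (ℕ × I)) [IsProbabilityMeasure μ]
    [Fintype F.edgeSet] [DecidableEq F.edgeSet] (hF : TwoConnected F) {n m : ℕ} (hn : 1 ≤ n)
    {ε D : ℝ} (hε0 : 0 ≤ ε) (hε1 : ε ≤ 1) (hD : 1 ≤ D) (hmn : (m : ℝ) ≤ D * n)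
    (hsmall : ∀ s : ℕ, 1 ≤ s → s ≤ Fintype.card W - 1 →
      (n : ℝ) ^ (1 + (s : ℝ) * (1 - 1 / (2 * (F.edgeSet.ncard : ℝ))))
        * ∫ a, containDensity n s a ∂μ ≤ ε)
    (S : Finset (F.edgeSet → Fin m)) (hS : ∀ f ∈ S, ∃ e e', f e ≠ f e') :
    ∑ _φ : W ↪ Fin n, ∑ f ∈ S,
        ∏ i ∈ Finset.univ.image f, ∫ a, containDensity n (rank (colourClass f i)) a ∂μ
      ≤ (Fintype.card F.edgeSet + 1) * ((Fintype.card F.edgeSet : ℝ) ^ Fintype.card F.edgeSet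
          * D ^ Fintype.card F.edgeSet) * ε * √n := by
  classical
  set θ : ℝ := 1 - 1 / (2 * (F.edgeSet.ncard : ℝ)) with hθ
  set v := Fintype.card W with hv
  have hn' : (0 : ℝ) < n := by exact_mod_cast hn
  have hn1 : (1 : ℝ) ≤ n := by exact_mod_cast hn
  have hterm : ∀ f ∈ S,
      ∏ i ∈ Finset.univ.image f, ∫ a, containDensity n (rank (colourClass f i)) a ∂μ
        ≤ ε * ((1 : ℝ) / n) ^ (Finset.univ.image f).card * (n : ℝ) ^ (1 / 2 - (v : ℝ)) := by
    intro f hf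
    obtain ⟨e₀, e₁, hne⟩ := hS f hf
    set r := (Finset.univ.image f).card
    set T := ∑ i ∈ Finset.univ.image f, rank (colourClass f i)
    have hr : 1 ≤ r := Finset.card_pos.2 ⟨f e₀, Finset.mem_image_of_mem f (Finset.mem_univ _)⟩
    have hT1 : v ≤ T := card_le_sum_rank_colourClass hF f ⟨e₀, e₁, hne⟩
    have hT2 : T ≤ F.edgeSet.ncard := sum_rank_colourClass_le f
    have hfac : ∀ i ∈ Finset.univ.image f, ∫ a, containDensity n (rank (colourClass f i)) a ∂μ
        ≤ ε / n * ((n : ℝ) ^ (-θ)) ^ rank (colourClass f i) := by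
      intro i hi
      obtain ⟨e, -, rfl⟩ := Finset.mem_image.1 hi
      have hb := colourClass_ne_bot f e
      have h1 := rank_lt_ncard_support hb
      have h2 : (colourClass f (f e)).support.ncard ≤ v := by
        rw [hv, ← Nat.card_eq_fintype_card, ← Set.ncard_univ]
        exact Set.ncard_le_ncard (Set.subset_univ _)
      have h3 := hsmall _ (one_le_rank hb) (by omega)
      set s := rank (colourClass f (f e))
      have hp : 0 < (n : ℝ) ^ (1 + (s : ℝ) * θ) := Real.rpow_pos_of_pos hn' _
      rw [mul_comm, ← le_div_iff₀ hp] at h3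
      refine h3.trans_eq ?_
      rw [← Real.rpow_mul_natCast hn'.le, Real.rpow_add hn', Real.rpow_one, div_mul_eq_div_div,
        neg_mul, Real.rpow_neg hn'.le, div_eq_mul_inv (ε / n), mul_comm θ]
    have hnn : ∀ i ∈ Finset.univ.image f,
        0 ≤ ∫ a, containDensity n (rank (colourClass f i)) a ∂μ :=
      fun i _ ↦ integral_nonneg fun a ↦ containDensity_nonneg _ _ a
    -- The product of the factors is `(ε / n) ^ r * n ^ (-θ T)`, and `θ T = T - T / (2 e_F) ≥ v - 1 / 2`.
    refine (Finset.prod_le_prod hnn hfac).trans ?_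
    rw [Finset.prod_mul_distrib, Finset.prod_const, Finset.prod_pow_eq_pow_sum, div_eq_mul_one_div,
      mul_pow]
    refine mul_le_mul ?_ ?_ (by positivity) (by positivity)
    · refine mul_le_mul_of_nonneg_right ?_ (by positivity)
      exact (pow_le_pow_of_le_one hε0 hε1 hr).trans_eq (pow_one ε)
    · rw [← Real.rpow_mul_natCast hn'.le]
      refine Real.rpow_le_rpow_of_exponent_le hn1 ?_
      have hT1' : (v : ℝ) ≤ T := by exact_mod_cast hT1
      have hT2' : (T : ℝ) ≤ F.edgeSet.ncard := by exact_mod_cast hT2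
      have h4 : (T : ℝ) * (1 / (2 * (F.edgeSet.ncard : ℝ))) ≤ 1 / 2 := by
        rw [mul_one_div, div_le_iff₀' (by
          have : 0 < F.edgeSet.ncard :=
            (Set.ncard_pos (Set.toFinite _)).2 ⟨e₀.1, e₀.2⟩
          positivity)]
        linarith
      change -θ * (T : ℝ) ≤ _
      rw [hθ]
      linarith
  have hcardφ : (Fintype.card (W ↪ Fin n) : ℝ) ≤ (n : ℝ) ^ v := by
    rw [Fintype.card_embedding_eq, Fintype.card_fin]
    exact_mod_cast Nat.descFactorial_le_pow n v
  have hsum := sum_pow_card_image_le (E := F.edgeSet) m (x := 1 / (n : ℝ)) (by positivity) hD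
    (by rw [mul_one_div, div_le_iff₀ hn']; exact hmn)
  set C : ℝ := (Fintype.card F.edgeSet + 1) * ((Fintype.card F.edgeSet : ℝ)
    ^ Fintype.card F.edgeSet * D ^ Fintype.card F.edgeSet)
  have hC : ∑ f ∈ S, ((1 : ℝ) / n) ^ (Finset.univ.image f).card ≤ C :=
    (Finset.sum_le_sum_of_subset_of_nonneg (Finset.subset_univ S)
      fun _ _ _ ↦ by positivity).trans hsum
  have hC0 : 0 ≤ C := (Finset.sum_nonneg fun _ _ ↦ by positivity).trans hC
  rw [Finset.sum_const, nsmul_eq_mul, Finset.card_univ]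
  calc (Fintype.card (W ↪ Fin n) : ℝ) * ∑ f ∈ S,
        ∏ i ∈ Finset.univ.image f, ∫ a, containDensity n (rank (colourClass f i)) a ∂μ
      ≤ (n : ℝ) ^ v * ∑ f ∈ S,
          ε * ((1 : ℝ) / n) ^ (Finset.univ.image f).card * (n : ℝ) ^ (1 / 2 - (v : ℝ)) := by
        refine mul_le_mul hcardφ (Finset.sum_le_sum hterm) ?_ (by positivity)
        exact Finset.sum_nonneg fun f _ ↦ Finset.prod_nonneg fun i _ ↦
          integral_nonneg fun a ↦ containDensity_nonneg _ _ a
    _ = (∑ f ∈ S, ((1 : ℝ) / n) ^ (Finset.univ.image f).card) * ε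
          * ((n : ℝ) ^ v * (n : ℝ) ^ (1 / 2 - (v : ℝ))) := by
        rw [← Finset.sum_mul, ← Finset.mul_sum]
        ring
    _ = (∑ f ∈ S, ((1 : ℝ) / n) ^ (Finset.univ.image f).card) * ε * √n := by
        rw [← Real.rpow_natCast, ← Real.rpow_add hn', Real.sqrt_eq_rpow]
        congr 2
        ring
    _ ≤ C * ε * √n := by gcongr

/-- The mean absolute error made by counting the copies of `F` layer by layer. -/
lemma integral_abs_networkCount_sub_sum_le (μ : Measure (ℕ × I)) [IsProbabilityMeasure μ]
    [Fintype F.edgeSet] [DecidableEq F.edgeSet] (hF : TwoConnected F)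
    (hsupp : F.support = Set.univ) (he : 2 ≤ F.edgeSet.ncard) {n m : ℕ} (hn : 1 ≤ n)
    {ε D : ℝ} (hε0 : 0 ≤ ε) (hε1 : ε ≤ 1) (hD : 1 ≤ D) (hmn : (m : ℝ) ≤ D * n)
    (hsmall : ∀ s : ℕ, 1 ≤ s → s ≤ Fintype.card W - 1 →
      (n : ℝ) ^ (1 + (s : ℝ) * (1 - 1 / (2 * (F.edgeSet.ncard : ℝ))))
        * ∫ a, containDensity n s a ∂μ ≤ ε) :
    ∫ ω, |networkCount F ω - ∑ i, ((layerGraphs ω i).copyCount F : ℝ)| ∂(networkLaw μ n m)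
      ≤ (Fintype.card F.edgeSet + 1) * ((Fintype.card F.edgeSet : ℝ) ^ Fintype.card F.edgeSet
          * D ^ Fintype.card F.edgeSet) * ε * √n := by
  classical
  set S : Finset (F.edgeSet → Fin m) := Finset.univ.filter fun f ↦ ∃ e e', f e ≠ f e'
  have hS : ∀ f ∈ S, ∃ e e', f e ≠ f e' := fun f hf ↦ (Finset.mem_filter.1 hf).2
  refine le_trans ?_ (sum_prod_integral_containDensity_le μ hF hn hε0 hε1 hD hmn hsmall S hS)
  calc ∫ ω, |networkCount F ω - ∑ i, ((layerGraphs ω i).copyCount F : ℝ)| ∂(networkLaw μ n m)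
      ≤ ∫ ω, ∑ φ : W ↪ Fin n, ∑ f ∈ S,
          (if Realises (layerGraphs ω) φ f then 1 else 0 : ℝ) ∂(networkLaw μ n m) := by
        refine integral_mono
          (integrable_comp_layerGraphs μ fun K ↦
            |((⨆ i, K i).copyCount F : ℝ) - ∑ i, ((K i).copyCount F : ℝ)|)
          (integrable_comp_layerGraphs μ fun K ↦ ∑ φ : W ↪ Fin n, ∑ f ∈ S,
            (if Realises K φ f then 1 else 0 : ℝ))
          fun ω ↦ ?_
        change |((⨆ i, layerGraphs ω i).copyCount F : ℝ) - ∑ i, ((layerGraphs ω i).copyCount F : ℝ)|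
          ≤ ∑ φ : W ↪ Fin n, ∑ f ∈ S, (if Realises (layerGraphs ω) φ f then 1 else 0 : ℝ)
        convert abs_copyCount_iSup_sub_sum_le hsupp he (layerGraphs ω)
    _ = ∑ φ : W ↪ Fin n, ∑ f ∈ S,
          (networkLaw μ n m).real {ω | Realises (layerGraphs ω) φ f} := by
        have hint : ∀ (φ : W ↪ Fin n) (f : F.edgeSet → Fin m), Integrable
            (fun ω ↦ (if Realises (layerGraphs ω) φ f then 1 else 0 : ℝ)) (networkLaw μ n m) :=
          fun φ f ↦ integrable_comp_layerGraphs μ fun K ↦ (if Realises K φ f then 1 else 0 : ℝ)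
        rw [integral_finsetSum _ fun φ _ ↦ integrable_finsetSum _ fun f _ ↦ hint φ f]
        refine Finset.sum_congr rfl fun φ _ ↦ ?_
        rw [integral_finsetSum _ fun f _ ↦ hint φ f]
        refine Finset.sum_congr rfl fun f _ ↦ ?_
        have hms : MeasurableSet {ω : Fin m → Layer n | Realises (layerGraphs ω) φ f} :=
          measurableSet_setOfPred.2 (measurable_comp_layerGraphs fun K ↦ Realises K φ f)
        rw [← integral_indicator_one hms]
        rfl
    _ ≤ _ := Finset.sum_le_sum fun φ _ ↦ Finset.sum_le_sum fun f _ ↦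
        networkLaw_real_realises_le μ φ f

end

/-! ### The number of copies in a single layer -/

section

variable {W : Type*} {F : SimpleGraph W}

/-- The number of copies of `F` in the restriction of `G(X, Q)` to its first `X ∧ n` vertices. -/
noncomputable def truncatedCount (F : SimpleGraph W) (n : ℕ) (g : Σ x : ℕ, SimpleGraph (Fin x)) :
    ℝ :=
  ((g.2.comap (Fin.castLE (min_le_left g.1 n))).copyCount F : ℝ)

/-- The space of finite graphs carries the discrete `σ`-algebra. -/
lemma measurable_sigma_fun {α : Type*} [MeasurableSpace α]
    (f : (Σ x : ℕ, SimpleGraph (Fin x)) → α) : Measurable f := by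
  intro s _
  refine MeasurableSpace.measurableSet_iInf.2 fun x ↦ ?_
  exact ((Set.toFinite (Sigma.mk x ⁻¹' (f ⁻¹' s))).measurableSet :
    MeasurableSet (Sigma.mk x ⁻¹' (f ⁻¹' s)))

lemma truncatedCount_nonneg (n : ℕ) (g : Σ x : ℕ, SimpleGraph (Fin x)) :
    0 ≤ truncatedCount F n g := Nat.cast_nonneg _

lemma truncatedCount_le_layerCount (hF : F.support = Set.univ) (n : ℕ)
    (g : Σ x : ℕ, SimpleGraph (Fin x)) : truncatedCount F n g ≤ layerCount F g :=
  Nat.cast_le.2 (copyCount_comap_le hF (Fin.castLEEmb (min_le_left g.1 n)) g.2)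

lemma truncatedCount_eq_layerCount {n : ℕ} {g : Σ x : ℕ, SimpleGraph (Fin x)} (h : g.1 ≤ n) :
    truncatedCount F n g = layerCount F g := by
  obtain ⟨x, G⟩ := g
  have key : ∀ (y : ℕ) (hy : y = x),
      ((G.comap (Fin.castLE hy.le)).copyCount F : ℝ) = G.copyCount F := by
    rintro _ rfl
    rfl
  exact key _ (min_eq_left h)

/-- The law of the number of copies of `F` in a Bernoulli random graph on `V ⊆ [n]` depends on `V` only
through its size. -/
lemma binomialRandom_setOf_copyCount_map_val (hF : F.support = Set.univ) {n k : ℕ} (q : I) {V : Finset (Fin n)}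
    (hV : V.card = k) (B : Set ℕ) :
    SimpleGraph.binomialRandom V q {G | (G.map (Subtype.val : V → Fin n)).copyCount F ∈ B}
      = SimpleGraph.binomialRandom (Fin k) q {G | G.copyCount F ∈ B} := by
  have hm : Measurable (SimpleGraph.comap (V.equivFinOfCardEq hV).symm.toEmbedding) :=
    fun _ _ ↦ (Set.toFinite _).measurableSet
  rw [← map_comap_binomialRandom (V.equivFinOfCardEq hV).symm.toEmbedding q,
    Measure.map_apply hm (Set.toFinite _).measurableSet]
  congr 1
  ext G
  simp only [Set.mem_ofPred_eq, Set.mem_preimage]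
  rw [show (G.map (Subtype.val : V → Fin n)).copyCount F = G.copyCount F from
    copyCount_map hF (Function.Embedding.subtype _) G, SimpleGraph.comap_symm,
    copyCount_map hF]

/-- The number of copies of `F` in a layer of `G_{[n,m]}` and in the restriction of `G(X, Q)` to
`X ∧ n` vertices have the same law. -/
lemma map_layerLaw_eq_map_mixedGraphLaw (hF : F.support = Set.univ) (μ : Measure (ℕ × I))
    [IsProbabilityMeasure μ] (n : ℕ) :
    (layerLaw μ n).map (fun ω ↦ (ω.2.2.copyCount F : ℝ))
      = (mixedGraphLaw μ).map (truncatedCount F n) := by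
  have hm1 : Measurable fun ω : Layer n ↦ (ω.2.2.copyCount F : ℝ) :=
    (Measurable.of_discrete (f := fun G : SimpleGraph (Fin n) ↦ (G.copyCount F : ℝ))).comp
      (measurable_snd.comp measurable_snd)
  have hm2 : Measurable (truncatedCount F n) := measurable_sigma_fun _
  ext B hB
  rw [Measure.map_apply hm1 hB, Measure.map_apply hm2 hB]
  set B' : Set ℕ := Nat.cast ⁻¹' B
  have hL : layerLaw μ n ((fun ω : Layer n ↦ (ω.2.2.copyCount F : ℝ)) ⁻¹' B)
      = ∫⁻ a, SimpleGraph.binomialRandom (Fin (min a.1 n)) a.2 {G | G.copyCount F ∈ B'} ∂μ := by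
    rw [layerLaw, Measure.compProd_apply (hm1 hB)]
    refine lintegral_congr fun a ↦ ?_
    rw [Kernel.compProd_apply (measurable_prodMk_left (hm1 hB))]
    have hae : ∀ᵐ V ∂(vertexSetKernel n a), V.card = min a.1 n := by
      change ∀ᵐ V ∂(uniformOn {V : Finset (Fin n) | V.card = min a.1 n}), V.card = min a.1 n
      exact ae_cond_mem (Set.toFinite _).measurableSet
    rw [lintegral_congr_ae (g := fun _ ↦ SimpleGraph.binomialRandom (Fin (min a.1 n)) a.2
      {G | G.copyCount F ∈ B'})]
    · simp
    filter_upwards [hae] with V hV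
    change (SimpleGraph.binomialRandom V a.2).map (SimpleGraph.map (Subtype.val : V → Fin n)) _ = _
    rw [Measure.map_apply (fun _ _ ↦ (Set.toFinite _).measurableSet)
      (Set.toFinite _).measurableSet]
    exact binomialRandom_setOf_copyCount_map_val hF a.2 hV B'
  rw [hL, mixedGraphLaw, Measure.bind_apply (hm2 hB) bernoulliGraphKernel.aemeasurable]
  refine lintegral_congr fun a ↦ ?_
  change _ = (SimpleGraph.binomialRandom (Fin a.1) a.2).map
    (fun G ↦ (⟨a.1, G⟩ : Σ x : ℕ, SimpleGraph (Fin x))) _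
  rw [Measure.map_apply (measurable_sigmaMk a.1) (hm2 hB),
    ← map_comap_binomialRandom (Fin.castLEEmb (min_le_left a.1 n)) a.2,
    Measure.map_apply (fun _ _ ↦ (Set.toFinite _).measurableSet) (Set.toFinite _).measurableSet]
  rfl

lemma memLp_truncatedCount (hF : F.support = Set.univ) {μ : Measure (ℕ × I)}
    (hN : MemLp (layerCount F) 2 (mixedGraphLaw μ)) (n : ℕ) :
    MemLp (truncatedCount F n) 2 (mixedGraphLaw μ) :=
  hN.mono (measurable_sigma_fun _).aestronglyMeasurable (ae_of_all _ fun g ↦ by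
    rw [Real.norm_of_nonneg (truncatedCount_nonneg n g)]
    exact (truncatedCount_le_layerCount hF n g).trans (le_abs_self _))

/-- The truncation of the layer size at `n` is asymptotically negligible in mean square. -/
lemma tendsto_variance_truncatedCount_sub (hF : F.support = Set.univ) (μ : Measure (ℕ × I))
    [IsProbabilityMeasure μ] (hN : MemLp (layerCount F) 2 (mixedGraphLaw μ)) :
    Tendsto (fun n ↦ Var[truncatedCount F n - layerCount F; mixedGraphLaw μ]) atTop (𝓝 0) := by
  have hlim : Tendsto (fun n ↦ ∫ g, (truncatedCount F n g - layerCount F g) ^ 2 ∂(mixedGraphLaw μ))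
      atTop (𝓝 0) := by
    have h0 : (0 : ℝ) = ∫ _ : (Σ x : ℕ, SimpleGraph (Fin x)), (0 : ℝ) ∂(mixedGraphLaw μ) := by simp
    rw [h0]
    refine tendsto_integral_of_dominated_convergence (fun g ↦ layerCount F g ^ 2)
      (fun n ↦ (measurable_sigma_fun _).aestronglyMeasurable) hN.integrable_sq (fun n ↦ ?_) ?_
    · refine ae_of_all _ fun g ↦ ?_
      have h1 := truncatedCount_nonneg (F := F) n g
      have h2 := truncatedCount_le_layerCount hF n g
      rw [Real.norm_of_nonneg (sq_nonneg _)]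
      nlinarith
    · refine ae_of_all _ fun g ↦ tendsto_const_nhds.congr' ?_
      filter_upwards [eventually_ge_atTop g.1] with n hn
      rw [truncatedCount_eq_layerCount hn, sub_self, zero_pow two_ne_zero]
  refine squeeze_zero (fun n ↦ variance_nonneg _ _) (fun n ↦ ?_) hlim
  exact variance_le_expectation_sq (measurable_sigma_fun _).aestronglyMeasurable

end

/-! ### Characteristic functions and the central limit theorem -/

section

lemma norm_charFun_map_sub_le {Ω : Type*} [MeasurableSpace Ω] (P : Measure Ω)
    [IsProbabilityMeasure P] {A B : Ω → ℝ} (hA : Measurable A) (hB : Measurable B)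
    (hAB : Integrable (fun ω ↦ A ω - B ω) P) (t : ℝ) :
    ‖charFun (P.map A) t - charFun (P.map B) t‖ ≤ |t| * ∫ ω, |A ω - B ω| ∂P := by
  have hc : ∀ {Z : Ω → ℝ}, Measurable Z →
      charFun (P.map Z) t = ∫ ω, Complex.exp (Complex.I * ((t * Z ω : ℝ) : ℂ)) ∂P := by
    intro Z hZ
    rw [charFun_apply_real, integral_map hZ.aemeasurable
      (by fun_prop : Continuous fun x : ℝ ↦ Complex.exp (t * x * Complex.I)).aestronglyMeasurable]
    refine integral_congr_ae (ae_of_all _ fun ω ↦ ?_)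
    push_cast
    congr 1
    ring
  have hi : ∀ {Z : Ω → ℝ}, Measurable Z →
      Integrable (fun ω ↦ Complex.exp (Complex.I * ((t * Z ω : ℝ) : ℂ))) P := by
    intro Z hZ
    refine Integrable.of_bound (by fun_prop) 1 (ae_of_all _ fun ω ↦ ?_)
    rw [Complex.norm_exp_I_mul_ofReal]
  rw [hc hA, hc hB, ← integral_sub (hi hA) (hi hB), ← integral_const_mul]
  refine norm_integral_le_of_norm_le (hAB.abs.const_mul _) (ae_of_all _ fun ω ↦ ?_)
  have h : Complex.exp (Complex.I * ((t * A ω : ℝ) : ℂ)) - Complex.exp (Complex.I * ((t * B ω : ℝ) : ℂ))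
      = Complex.exp (Complex.I * ((t * B ω : ℝ) : ℂ))
        * (Complex.exp (Complex.I * ((t * (A ω - B ω) : ℝ) : ℂ)) - 1) := by
    rw [mul_sub, ← Complex.exp_add, mul_one]
    congr 2
    push_cast
    ring
  rw [h, norm_mul, Complex.norm_exp_I_mul_ofReal, one_mul, ← abs_mul]
  exact Real.norm_exp_I_mul_ofReal_sub_one_le

/-- The mean absolute deviation is at most the standard deviation. -/
lemma integral_abs_sub_integral_le {Ω : Type*} [MeasurableSpace Ω] (P : Measure Ω)
    [IsProbabilityMeasure P] {Z : Ω → ℝ} (hZ : MemLp Z 2 P) :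
    ∫ ω, |Z ω - ∫ ω', Z ω' ∂P| ∂P ≤ √Var[Z; P] := by
  have h1 : MemLp (fun ω ↦ |Z ω - ∫ ω', Z ω' ∂P|) 2 P := (hZ.sub (memLp_const _)).abs
  refine Real.le_sqrt_of_sq_le ?_
  have h2 := variance_nonneg (fun ω ↦ |Z ω - ∫ ω', Z ω' ∂P|) P
  rw [variance_eq_sub h1] at h2
  rw [variance_eq_integral hZ.aestronglyMeasurable.aemeasurable]
  simpa [sq_abs] using h2

lemma charFun_map_mul_sum_pi {Ω : Type*} [MeasurableSpace Ω] (P : Measure Ω)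
    [IsProbabilityMeasure P] {U : Ω → ℝ} (hU : Measurable U) (m : ℕ) (r t : ℝ) :
    charFun ((Measure.pi fun _ : Fin m ↦ P).map fun g ↦ r * ∑ i, U (g i)) t
      = charFun (P.map U) (r * t) ^ m := by
  have := Measure.isProbabilityMeasure_map (μ := P) hU.aemeasurable
  rw [charFun_map_mul_comp (Measurable.aemeasurable (by fun_prop))]
  have h : (Measure.pi fun _ : Fin m ↦ P).map (fun g ↦ ∑ i, U (g i))
      = (Measure.pi fun _ : Fin m ↦ P.map U).map fun p ↦ ∑ i, p i := by
    rw [← Measure.pi_map_pi (fun _ ↦ hU.aemeasurable), Measure.map_map (by fun_prop) (by fun_prop)]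
    rfl
  rw [h, charFun_map_sum_pi_eq_prod]
  simp

/-- A central limit theorem for row-wise i.i.d. triangular arrays whose rows are coupled to a fixed
square integrable variable `Y`, with errors that vanish in mean square. -/
lemma tendsto_charFun_sum_of_tendsto_variance {Ω : Type*} [MeasurableSpace Ω] (P : Measure Ω)
    [IsProbabilityMeasure P] {Y : Ω → ℝ} {Z : ℕ → Ω → ℝ} (hYm : Measurable Y)
    (hZm : ∀ k, Measurable (Z k)) (hY : MemLp Y 2 P) (hZ : ∀ k, MemLp (Z k) 2 P)
    (hvar : 0 < Var[Y; P]) (hlim : Tendsto (fun k ↦ Var[Z k - Y; P]) atTop (𝓝 0))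
    {m : ℕ → ℕ} (hm : Tendsto m atTop atTop) (t : ℝ) :
    Tendsto (fun k ↦ charFun ((Measure.pi fun _ : Fin (m k) ↦ P).map fun g ↦
        (∑ i, Z k (g i) - m k * ∫ ω, Z k ω ∂P) / (√Var[Y; P] * √(m k : ℝ))) t) atTop
      (𝓝 (Complex.exp (-(t : ℂ) ^ 2 / 2))) := by
  set s : ℝ := √Var[Y; P] with hs
  have hs0 : 0 < s := Real.sqrt_pos.2 hvar
  set U : Ω → ℝ := fun ω ↦ (Y ω - ∫ ω', Y ω' ∂P) / s with hU
  have hUm : Measurable U := (hYm.sub_const _).div_const _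
  have hYi : Integrable Y P := hY.integrable (by norm_num)
  have hZi : ∀ k, Integrable (Z k) P := fun k ↦ (hZ k).integrable (by norm_num)
  have hU0 : P[U] = 0 := by
    rw [hU, integral_div, integral_sub hYi (by simp)]
    simp
  have hU1 : P[U ^ 2] = 1 := by
    simp only [hU, Pi.pow_apply, div_pow]
    rw [integral_div, ← variance_eq_integral hYm.aemeasurable, hs, Real.sq_sqrt hvar.le,
      div_self hvar.ne']
  have hclt := (tendsto_charFun_inv_sqrt_mul_pow hUm.aemeasurable hU0 hU1 t).comp hm
  refine (tendsto_iff_of_dist ?_).1 hclt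
  refine squeeze_zero' (g := fun k ↦ |t| * (√Var[Z k - Y; P] / s))
    (Eventually.of_forall fun k ↦ dist_nonneg) ?_ ?_
  · filter_upwards [hm.eventually_ge_atTop 1] with k hk
    have hmk : (0 : ℝ) < m k := by exact_mod_cast hk
    have hmk' : 0 < √(m k : ℝ) := Real.sqrt_pos.2 hmk
    set Q := Measure.pi fun _ : Fin (m k) ↦ P
    simp only [Function.comp_apply]
    rw [← charFun_map_mul_sum_pi P hUm (m k), dist_comm, dist_eq_norm]
    set A : (Fin (m k) → Ω) → ℝ := fun g ↦
      (∑ i, Z k (g i) - m k * ∫ ω, Z k ω ∂P) / (s * √(m k : ℝ)) with hA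
    set B : (Fin (m k) → Ω) → ℝ := fun g ↦ (√(m k : ℝ))⁻¹ * ∑ i, U (g i) with hB
    set D : Ω → ℝ := Z k - Y with hD
    have hDm : MemLp D 2 P := (hZ k).sub hY
    set T : (Fin (m k) → Ω) → ℝ := fun g ↦ ∑ i, D (g i) with hT
    have hTm : MemLp T 2 Q := memLp_finsetSum _ fun i _ ↦
      hDm.comp_measurePreserving (measurePreserving_eval _ i)
    have hDi : ∀ i : Fin (m k), Integrable (fun g : Fin (m k) → Ω ↦ D (g i)) Q := fun i ↦
      (hDm.comp_measurePreserving (measurePreserving_eval (fun _ : Fin (m k) ↦ P) i)).integrable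
        (by norm_num)
    have hTint : ∫ g, T g ∂Q = m k * (∫ ω, Z k ω ∂P - ∫ ω, Y ω ∂P) := by
      rw [hT, integral_finsetSum _ fun i _ ↦ hDi i]
      have : ∀ i : Fin (m k), ∫ g, D (g i) ∂Q = ∫ ω, Z k ω ∂P - ∫ ω, Y ω ∂P := by
        intro i
        rw [← integral_sub (hZi k) hYi]
        exact integral_comp_eval (μ := fun _ : Fin (m k) ↦ P) hDm.aestronglyMeasurable
      simp [this, mul_sub]
    have hTvar : Var[T; Q] = m k * Var[D; P] := by
      have h := variance_sum_pi (μ := fun _ : Fin (m k) ↦ P) (X := fun _ ↦ D) fun _ ↦ hDm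
      have hT' : T = ∑ i, fun g : Fin (m k) → Ω ↦ D (g i) := by
        ext g
        simp [hT]
      rw [hT', h]
      simp
    have hdiff : ∀ g, A g - B g = (T g - ∫ g', T g' ∂Q) / (s * √(m k : ℝ)) := by
      intro g
      rw [hTint]
      simp only [hA, hB, hT, hU, hD, Pi.sub_apply, Finset.sum_sub_distrib, ← Finset.sum_div,
        Finset.sum_const, Finset.card_univ, Fintype.card_fin, nsmul_eq_mul]
      field_simp
      ring
    have hAm : Measurable A := by
      have := hZm k
      fun_prop
    have hBm : Measurable B := by fun_prop
    have hABi : Integrable (fun g ↦ A g - B g) Q := by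
      simp only [hdiff]
      exact ((hTm.integrable (by norm_num)).sub (integrable_const _)).div_const _
    refine (norm_charFun_map_sub_le Q hAm hBm hABi t).trans ?_
    refine mul_le_mul_of_nonneg_left ?_ (abs_nonneg t)
    simp only [hdiff, abs_div, abs_of_pos (mul_pos hs0 hmk')]
    rw [integral_div, div_le_div_iff₀ (mul_pos hs0 hmk') hs0]
    have h3 := integral_abs_sub_integral_le Q hTm
    rw [hTvar, Real.sqrt_mul hmk.le] at h3
    calc _ ≤ √(m k : ℝ) * √Var[D; P] * s := mul_le_mul_of_nonneg_right h3 hs0.le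
      _ = _ := by ring
  · have h := ((Real.continuous_sqrt.tendsto 0).comp hlim).div_const s |>.const_mul |t|
    simpa using h

variable {W : Type*} [Fintype W] {F : SimpleGraph W}

/-- The remainder is of smaller order than `√m` in mean. -/
lemma tendsto_integral_abs_networkCount_sub_sum (μ : Measure (ℕ × I)) [IsProbabilityMeasure μ]
    (hF : TwoConnected F) (hsupp : F.support = Set.univ) (he : 2 ≤ F.edgeSet.ncard)
    {ν : ℝ} (hν : 0 < ν) {n m : ℕ → ℕ} (hn : Tendsto n atTop atTop)
    (hmn : Tendsto (fun k ↦ (m k : ℝ) / (n k : ℝ)) atTop (𝓝 ν))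
    (hmom : ∀ s : ℕ, 1 ≤ s → s ≤ Fintype.card W - 1 →
      Integrable (fun a : ℕ × I ↦
        (a.1 : ℝ) ^ (1 + (s : ℝ) * (1 - 1 / (2 * (F.edgeSet.ncard : ℝ)))) * (a.2 : ℝ) ^ s) μ) :
    Tendsto (fun k ↦ (∫ ω, |networkCount F ω - ∑ i, ((layerGraphs ω i).copyCount F : ℝ)|
      ∂(networkLaw μ (n k) (m k))) / √(m k : ℝ)) atTop (𝓝 0) := by
  classical
  set C : ℝ := (Fintype.card F.edgeSet + 1) * ((Fintype.card F.edgeSet : ℝ)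
    ^ Fintype.card F.edgeSet * (ν + 1) ^ Fintype.card F.edgeSet) with hC
  have hC0 : 0 < C := by
    have : 0 < Fintype.card F.edgeSet := by
      rw [← Nat.card_eq_fintype_card, Nat.card_coe_set_eq]
      omega
    positivity
  have he' : (2 : ℝ) ≤ F.edgeSet.ncard := by exact_mod_cast he
  have hθ0 : 0 ≤ 1 - 1 / (2 * (F.edgeSet.ncard : ℝ)) := by
    rw [sub_nonneg, div_le_one (by positivity)]
    linarith
  have hθ1 : 1 - 1 / (2 * (F.edgeSet.ncard : ℝ)) < 1 := by
    have : 0 < 1 / (2 * (F.edgeSet.ncard : ℝ)) := by positivity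
    linarith
  have hsmall : ∀ ε : ℝ, 0 < ε → ∀ᶠ n : ℕ in atTop, ∀ s ∈ Finset.Icc 1 (Fintype.card W - 1),
      (n : ℝ) ^ (1 + (s : ℝ) * (1 - 1 / (2 * (F.edgeSet.ncard : ℝ))))
        * ∫ a, containDensity n s a ∂μ ≤ ε := by
    intro ε hε
    rw [Filter.eventually_all_finset]
    intro s hs
    obtain ⟨hs1, hs2⟩ := Finset.mem_Icc.1 hs
    exact (tendsto_rpow_mul_integral_containDensity μ hs1 hθ0 hθ1
      (hmom s hs1 hs2)).eventually_le_const hε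
  rw [Metric.tendsto_atTop']
  intro η hη
  set K : ℝ := C * √(2 / ν)
  have hK : 0 < K := mul_pos hC0 (Real.sqrt_pos.2 (by positivity))
  set ε : ℝ := min 1 (η / (2 * K))
  have hε : 0 < ε := by positivity
  have hev : ∀ᶠ k in atTop, dist ((∫ ω, |networkCount F ω - ∑ i, ((layerGraphs ω i).copyCount F : ℝ)|
      ∂(networkLaw μ (n k) (m k))) / √(m k : ℝ)) 0 < η := by
    filter_upwards [hn.eventually_ge_atTop 1, hn.eventually (hsmall ε hε),
      hmn.eventually_le_const (by linarith : ν < ν + 1),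
      hmn.eventually_const_le (by linarith : ν / 2 < ν)] with k hk1 hk2 hk3 hk4
    have hn0 : (0 : ℝ) < n k := by exact_mod_cast hk1
    rw [div_le_iff₀ hn0] at hk3
    rw [le_div_iff₀ hn0] at hk4
    have hm0 : (0 : ℝ) < m k := lt_of_lt_of_le (by positivity) hk4
    have hbound := integral_abs_networkCount_sub_sum_le μ hF hsupp he hk1 hε.le (min_le_left _ _)
      (by linarith : (1 : ℝ) ≤ ν + 1) hk3
      (fun s hs1 hs2 ↦ hk2 s (Finset.mem_Icc.2 ⟨hs1, hs2⟩))
    rw [← hC] at hbound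
    have hsq : √(n k : ℝ) ≤ √(2 / ν) * √(m k : ℝ) := by
      rw [← Real.sqrt_mul (by positivity)]
      refine Real.sqrt_le_sqrt ?_
      rw [div_mul_eq_mul_div, le_div_iff₀ hν]
      linarith
    rw [Real.dist_eq, sub_zero, abs_of_nonneg (by positivity),
      div_lt_iff₀ (Real.sqrt_pos.2 hm0)]
    calc _ ≤ C * ε * √(n k : ℝ) := hbound
      _ ≤ C * ε * (√(2 / ν) * √(m k : ℝ)) := by gcongr
      _ = K * ε * √(m k : ℝ) := by ring
      _ ≤ K * (η / (2 * K)) * √(m k : ℝ) := by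
        gcongr
        exact min_le_right _ _
      _ = η / 2 * √(m k : ℝ) := by field_simp
      _ < η * √(m k : ℝ) := by
        have := Real.sqrt_pos.2 hm0
        nlinarith
  obtain ⟨N, hN⟩ := eventually_atTop.1 hev
  exact ⟨N, fun k hk ↦ hN k hk.le⟩

omit [Fintype W] in
/-- The normalised sum of the numbers of copies in the layers has the same law as the corresponding
sum of independent copies of the truncated count of `G(X, Q)`. -/
lemma map_networkLaw_sum_copyCount (hsupp : F.support = Set.univ) (μ : Measure (ℕ × I))
    [IsProbabilityMeasure μ] (n m : ℕ) :
    (networkLaw μ n m).map (fun ω ↦ ∑ i, ((layerGraphs ω i).copyCount F : ℝ))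
      = (Measure.pi fun _ : Fin m ↦ mixedGraphLaw μ).map fun g ↦ ∑ i, truncatedCount F n (g i) := by
  have hm1 : Measurable fun ω : Layer n ↦ (ω.2.2.copyCount F : ℝ) :=
    (Measurable.of_discrete (f := fun G : SimpleGraph (Fin n) ↦ (G.copyCount F : ℝ))).comp
      (measurable_snd.comp measurable_snd)
  have hm2 : Measurable (truncatedCount F n) := measurable_sigma_fun _
  have := Measure.isProbabilityMeasure_map (μ := layerLaw μ n) hm1.aemeasurable
  have := Measure.isProbabilityMeasure_map (μ := mixedGraphLaw μ) hm2.aemeasurable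
  have h1 : (networkLaw μ n m).map (fun ω i ↦ ((ω i).2.2.copyCount F : ℝ))
      = (Measure.pi fun _ : Fin m ↦ mixedGraphLaw μ).map fun g i ↦ truncatedCount F n (g i) := by
    rw [networkLaw, Measure.pi_map_pi (fun _ ↦ hm1.aemeasurable),
      Measure.pi_map_pi (fun _ ↦ hm2.aemeasurable), map_layerLaw_eq_map_mixedGraphLaw hsupp]
  have hsum : Measurable fun p : Fin m → ℝ ↦ ∑ i, p i := by fun_prop
  have h2 := congrArg (Measure.map fun p : Fin m → ℝ ↦ ∑ i, p i) h1
  have hm1' : Measurable fun (ω : Fin m → Layer n) i ↦ ((ω i).2.2.copyCount F : ℝ) :=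
    measurable_pi_lambda _ fun i ↦ hm1.comp (measurable_pi_apply i)
  have hm2' : Measurable fun (g : Fin m → Σ x : ℕ, SimpleGraph (Fin x)) i ↦
      truncatedCount F n (g i) :=
    measurable_pi_lambda _ fun i ↦ hm2.comp (measurable_pi_apply i)
  rw [Measure.map_map hsum hm1', Measure.map_map hsum hm2'] at h2
  exact h2

omit [Fintype W] in
/-- The characteristic functions of the normalised count and of the normalised sum of independent
truncated counts differ by at most a multiple of the mean absolute remainder. -/
lemma norm_charFun_networkCount_sub_le (hsupp : F.support = Set.univ) (μ : Measure (ℕ × I))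
    [IsProbabilityMeasure μ] (hN : MemLp (layerCount F) 2 (mixedGraphLaw μ)) (n m : ℕ) {s : ℝ}
    (hs : 0 < s) (t : ℝ) :
    ‖charFun ((networkLaw μ n m).map fun ω ↦
        (networkCount F ω - ∫ ω', networkCount F ω' ∂(networkLaw μ n m)) / (s * √(m : ℝ))) t
      - charFun ((Measure.pi fun _ : Fin m ↦ mixedGraphLaw μ).map fun g ↦
        (∑ i, truncatedCount F n (g i) - m * ∫ g', truncatedCount F n g' ∂(mixedGraphLaw μ))
          / (s * √(m : ℝ))) t‖
      ≤ |t| * (2 / s * ((∫ ω, |networkCount F ω - ∑ i, ((layerGraphs ω i).copyCount F : ℝ)|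
          ∂(networkLaw μ n m)) / √(m : ℝ))) := by
  set L := networkLaw μ n m
  set S : (Fin m → Layer n) → ℝ := fun ω ↦ ∑ i, ((layerGraphs ω i).copyCount F : ℝ)
  have hSi : Integrable S L :=
    integrable_comp_layerGraphs μ fun K ↦ ∑ i, ((K i).copyCount F : ℝ)
  have hSm : Measurable S := measurable_comp_layerGraphs fun K ↦ ∑ i, ((K i).copyCount F : ℝ)
  have hNi : Integrable (networkCount F) L :=
    integrable_comp_layerGraphs μ fun K ↦ ((⨆ i, K i).copyCount F : ℝ)
  have hNm : Measurable (networkCount F : (Fin m → Layer n) → ℝ) :=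
    measurable_comp_layerGraphs fun K ↦ ((⨆ i, K i).copyCount F : ℝ)
  have hgm : Measurable fun g : Fin m → (Σ x : ℕ, SimpleGraph (Fin x)) ↦
      ∑ i, truncatedCount F n (g i) := by
    have := measurable_sigma_fun (truncatedCount F n)
    fun_prop
  have hmap : L.map S = _ := map_networkLaw_sum_copyCount (F := F) hsupp μ n m
  set c : ℝ := ∫ g, truncatedCount F n g ∂(mixedGraphLaw μ)
  have hi : ∀ i : Fin m, Integrable (fun g : Fin m → (Σ x : ℕ, SimpleGraph (Fin x)) ↦
      truncatedCount F n (g i)) (Measure.pi fun _ : Fin m ↦ mixedGraphLaw μ) := fun i ↦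
    ((memLp_truncatedCount hsupp hN n).comp_measurePreserving
      (measurePreserving_eval (fun _ : Fin m ↦ mixedGraphLaw μ) i)).integrable (by norm_num)
  have hSint : ∫ ω, S ω ∂L = m * c := by
    have h1 : ∫ ω, S ω ∂L = ∫ x, x ∂(L.map S) := by
      rw [integral_map hSm.aemeasurable (f := fun x : ℝ ↦ x) (by fun_prop)]
    rw [h1, hmap, integral_map hgm.aemeasurable (f := fun x : ℝ ↦ x) (by fun_prop),
      integral_finsetSum _ fun i _ ↦ hi i]
    have : ∀ i : Fin m, ∫ g, truncatedCount F n (g i)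
        ∂(Measure.pi fun _ : Fin m ↦ mixedGraphLaw μ) = c := fun i ↦
      integral_comp_eval (μ := fun _ : Fin m ↦ mixedGraphLaw μ)
        (measurable_sigma_fun (truncatedCount F n)).aestronglyMeasurable
    simp [this]
  set A : (Fin m → Layer n) → ℝ := fun ω ↦ (S ω - m * c) / (s * √(m : ℝ)) with hA
  have hAm : Measurable A := (hSm.sub_const _).div_const _
  have hlaw : L.map A = (Measure.pi fun _ : Fin m ↦ mixedGraphLaw μ).map fun g ↦
      (∑ i, truncatedCount F n (g i) - m * c) / (s * √(m : ℝ)) := by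
    have hφ : Measurable fun x : ℝ ↦ (x - m * c) / (s * √(m : ℝ)) := by fun_prop
    have h1 := congrArg (Measure.map fun x : ℝ ↦ (x - m * c) / (s * √(m : ℝ))) hmap
    rw [Measure.map_map hφ hSm, Measure.map_map hφ hgm] at h1
    exact h1
  rw [← hlaw]
  have hdiff : ∀ ω, (networkCount F ω - ∫ ω', networkCount F ω' ∂L) / (s * √(m : ℝ)) - A ω
      = ((networkCount F ω - S ω) - ∫ ω', (networkCount F ω' - S ω') ∂L) / (s * √(m : ℝ)) := by
    intro ω
    rw [integral_sub hNi hSi, hSint, hA, ← sub_div]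
    congr 1
    ring
  have hRi : Integrable (fun ω ↦ networkCount F ω - S ω) L := hNi.sub hSi
  refine (norm_charFun_map_sub_le L ((hNm.sub_const _).div_const _) hAm ?_ t).trans ?_
  · simp only [hdiff]
    exact (hRi.sub (integrable_const _)).div_const _
  refine mul_le_mul_of_nonneg_left ?_ (abs_nonneg t)
  simp only [hdiff, abs_div, abs_of_nonneg (mul_nonneg hs.le (Real.sqrt_nonneg (m : ℝ)))]
  rw [integral_div, div_mul_div_comm]
  refine div_le_div_of_nonneg_right ?_ (by positivity)
  calc ∫ ω, |networkCount F ω - S ω - ∫ ω', (networkCount F ω' - S ω') ∂L| ∂L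
      ≤ ∫ ω, (|networkCount F ω - S ω| + ∫ ω', |networkCount F ω' - S ω'| ∂L) ∂L := by
        refine integral_mono (hRi.sub (integrable_const _)).abs
          (hRi.abs.add (integrable_const _)) fun ω ↦ ?_
        exact (abs_sub _ _).trans (add_le_add le_rfl abs_integral_le_integral_abs)
    _ = 2 * ∫ ω, |networkCount F ω - S ω| ∂L := by
        rw [integral_add hRi.abs (integrable_const _)]
        simp [two_mul]

end

end CommunityNetwork


open CommunityNetwork in
theorem theorem1
    {Ω : Type*} [MeasurableSpace Ω] (P : Measure Ω) [IsProbabilityMeasure P]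
    (X : Ω → ℕ) (Q : Ω → I)
    (μ : Measure (ℕ × I)) [IsProbabilityMeasure μ]
    (hμ : HasLaw (fun ω ↦ (X ω, Q ω)) μ P)
    {W : Type*} [Fintype W] (F : SimpleGraph W)
    (hF : CommunityNetwork.TwoConnected F) (hvF : 3 ≤ Fintype.card W)
    (ν : ℝ) (hν : 0 < ν) (n m : ℕ → ℕ)
    (hn : Tendsto n atTop atTop) (hm : Tendsto m atTop atTop)
    (hmn : Tendsto (fun k ↦ (m k : ℝ) / (n k : ℝ)) atTop (𝓝 ν))
    (hX : Integrable (fun ω ↦ (X ω : ℝ)) P)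
    (hσ_pos : 0 < CommunityNetwork.sigmaSq F μ)
    (hσ_fin : CommunityNetwork.sigmaSq F μ < ∞)
    (hmom : ∀ s : ℕ, 1 ≤ s → s ≤ Fintype.card W - 1 →
      Integrable (fun ω ↦
        (X ω : ℝ) ^ (1 + (s : ℝ) * (1 - 1 / (2 * (F.edgeSet.ncard : ℝ)))) * (Q ω : ℝ) ^ s) P) :
    TendstoInDistribution
      (fun (k : ℕ) (ω : Fin (m k) → CommunityNetwork.Layer (n k)) ↦
        (CommunityNetwork.networkCount F ω
            - ∫ ω', CommunityNetwork.networkCount F ω'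
                ∂(CommunityNetwork.networkLaw μ (n k) (m k)))
          / (√(CommunityNetwork.sigmaSq F μ).toReal * √(m k : ℝ)))
      atTop (id : ℝ → ℝ)
      (fun k ↦ CommunityNetwork.networkLaw μ (n k) (m k))
      (gaussianReal 0 1) := by
  classical
  have hnt : Nontrivial W := Fintype.one_lt_card_iff_nontrivial.1 (by omega)
  have hsupp : F.support = Set.univ := hF.1.preconnected.support_eq_univ
  have he : 2 ≤ F.edgeSet.ncard := by
    have h1 := hF.1.card_vert_le_card_edgeSet_add_one
    rw [Nat.card_eq_fintype_card, Nat.card_coe_set_eq] at h1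
    omega
  have hmom' : ∀ s : ℕ, 1 ≤ s → s ≤ Fintype.card W - 1 → Integrable (fun a : ℕ × I ↦
      (a.1 : ℝ) ^ (1 + (s : ℝ) * (1 - 1 / (2 * (F.edgeSet.ncard : ℝ)))) * (a.2 : ℝ) ^ s) μ := by
    intro s hs1 hs2
    have hmeas : Measurable fun a : ℕ × I ↦
        (a.1 : ℝ) ^ (1 + (s : ℝ) * (1 - 1 / (2 * (F.edgeSet.ncard : ℝ)))) * (a.2 : ℝ) ^ s :=
      ((measurable_of_countable fun x : ℕ ↦
        (x : ℝ) ^ (1 + (s : ℝ) * (1 - 1 / (2 * (F.edgeSet.ncard : ℝ))))).comp measurable_fst).mul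
        ((measurable_subtype_coe.comp measurable_snd).pow_const s)
    rw [← hμ.map_eq, integrable_map_measure hmeas.aestronglyMeasurable hμ.aemeasurable]
    exact hmom s hs1 hs2
  have hN : MemLp (layerCount F) 2 (mixedGraphLaw μ) :=
    (evariance_lt_top_iff_memLp (measurable_sigma_fun _).aestronglyMeasurable).1 hσ_fin
  have hvar : 0 < Var[layerCount F; mixedGraphLaw μ] := ENNReal.toReal_pos hσ_pos.ne' hσ_fin.ne
  set s : ℝ := √Var[layerCount F; mixedGraphLaw μ] with hs
  have hs0 : 0 < s := Real.sqrt_pos.2 hvar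
  have hmeas : ∀ k, Measurable fun ω : Fin (m k) → Layer (n k) ↦
      (networkCount F ω - ∫ ω', networkCount F ω' ∂(networkLaw μ (n k) (m k)))
        / (√(sigmaSq F μ).toReal * √(m k : ℝ)) := fun k ↦
    measurable_comp_layerGraphs fun K ↦ (((⨆ i, K i).copyCount F : ℝ)
      - ∫ ω', networkCount F ω' ∂(networkLaw μ (n k) (m k)))
        / (√(sigmaSq F μ).toReal * √(m k : ℝ))
  refine ⟨fun k ↦ (hmeas k).aemeasurable, aemeasurable_id, ?_⟩
  refine ProbabilityMeasure.tendsto_iff_tendsto_charFun.2 fun t ↦ ?_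
  simp only [ProbabilityMeasure.coe_mk, Measure.map_id]
  have hgauss : charFun (gaussianReal 0 1) t = Complex.exp (-(t : ℂ) ^ 2 / 2) := by
    rw [charFun_gaussianReal]
    congr 1
    push_cast
    ring
  rw [hgauss]
  have hvarlim := (tendsto_variance_truncatedCount_sub hsupp μ hN).comp hn
  have hclt := tendsto_charFun_sum_of_tendsto_variance (mixedGraphLaw μ)
    (Y := layerCount F) (Z := fun k ↦ truncatedCount F (n k)) (measurable_sigma_fun _)
    (fun k ↦ measurable_sigma_fun _) hN (fun k ↦ memLp_truncatedCount hsupp hN (n k)) hvar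
    hvarlim hm t
  refine (tendsto_iff_of_dist ?_).1 hclt
  have hrem := tendsto_integral_abs_networkCount_sub_sum μ hF hsupp he hν hn hmn hmom'
  refine squeeze_zero (g := fun k ↦ |t| * (2 / s * ((∫ ω, |networkCount F ω
      - ∑ i, ((layerGraphs ω i).copyCount F : ℝ)| ∂(networkLaw μ (n k) (m k))) / √(m k : ℝ))))
    (fun k ↦ dist_nonneg) (fun k ↦ ?_) ?_
  swap
  · simpa using (hrem.const_mul (2 / s)).const_mul |t|
  rw [dist_comm, dist_eq_norm]
  exact norm_charFun_networkCount_sub_le hsupp μ hN (n k) (m k) hs0 t
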